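/- **Definitions.** A *derivation system* $\mathcal R$ consists of a set $\mathrm{Seq}$ of sequents and a set of rules $R$, each with a conclusion $\Gamma$ and finitely many premises $\Delta_1,\dots,\Delta_n$ in $\mathrm{Seq}$. An *$\mathcal R$-preproof* is a finite tree $T$ whose nodes are labelled by sequents, with a partial function $\beta$ from leaves (*buds*) to proper prefixes (*companions*) such that a bud and its companion have the same label, and every node that is not a bud is either labelled with a rule whose conclusion labels the node and whose premises label its children in order, or is an open leaf. An *activation algebra* $\mathcal A$ is a finite join-semilattice with least element $0$ and a fixed element $\alpha\ne 0$. The category $\mathcal T_{\mathcal A}$ has finite sets as objects and subsets $R\subseteq X\times\mathcal A\times Y$ as morphisms $X\to Y$; $(x,c,z)\in R'\circ R$ iff $(x,a,y)\in R$, $(y,b,z)\in R'$ and $a\vee b=c$ for some $y,a,b$; the identities are $\{(x,0,x)\}$. A functor $P:\omega\to\mathcal T_{\mathcal A}$ satisfies the *trace condition* if there are $s_0<s_1<\cdots$ and $x_i\in P(s_i)$ with $(x_i,\alpha,x_{i+1})\in P(s_i<s_{i+1})$ for all $i$. A *trace interpretation* $\iota$ assigns to each sequent an object and to each rule with conclusion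 $\Gamma$ and premises $\Delta_1,\dots,\Delta_n$ morphisms $r_i:\iota(\Gamma)\to\iota(\Delta_i)$. A preproof is a *proof in $\mathcal R$* (w.r.t. $\iota$) if it has no open leaves and for each infinite branch from the root (which continues from a bud at its companion) the induced path, with the morphisms $r_i$ at rules and identities at buds, satisfies the trace condition. Fix a countably infinite set of *chips*. A *Safra board* on $X$ is a pair $(\Theta,\sigma)$ of a finite linearly ordered set $\Theta$ of chips (the *control*) and a map $\sigma:X\times\mathcal A\to\mathcal P(\mathcal P(\Theta))$ such that each chip of $\Theta$ lies in some stack $S\in\sigma(x,a)$; the top of a stack is its greatest chip, and a chip is *covered* if it is on top of no stack. There are four kinds of transitions, where the control of the new board is ordered as in the old one unless said otherwise and consists of the chips still in use. *Weakening*: remove some stacks. *Reset* $R_\gamma$, for a covered $\gamma\in\Theta$: remove all chips above $\gamma$ from every stack containing $\gamma$. *Population*: add the empty stack to some of the sets $\sigma(x,0)$. *$\tau$-successor*, for $\tau:X\to Y$: put $\sigma^*(y,a)=\{S\mid S\in\sigma(x,b),\,(x,c,y)\in\tau,\,a=b\vee c\text{ for some }x,b,c\}$; then, for each $y$ with $\sigma^*(y,\alpha)\neq\emptyset$,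 add one fresh chip (not in $\Theta$, different chips for different $y$) to all the stacks on $(y,\alpha)$ and move them to $(y,0)$; the fresh chips are put above all others in the control, in any order. The *reset system* $\mathrm R(\mathcal R)$ has as sequents the pairs $\Gamma;(\Theta,\sigma)$ with $(\Theta,\sigma)$ a Safra board on $\iota(\Gamma)$. Its rules are the unary structural rules with conclusion $\Gamma;(\Theta,\sigma)$ and premise $\Gamma;(\Theta',\sigma')$, for every weakening, reset or population $(\Theta',\sigma')$ of $(\Theta,\sigma)$, and, for each rule $R$ as above, all rules with conclusion $\Gamma;(\Theta,\sigma)$ and premises $\Delta_i;(\Theta_i,\sigma_i)$ where $(\Theta_i,\sigma_i)$ is an $r_i$-successor of $(\Theta,\sigma)$. A preproof of $\mathrm R(\mathcal R)$ without open leaves is a *proof* if for every bud $t$ there is a non-empty common prefix $\theta$ of all the controls on the path from $\beta(t)$ to $t$ such that a $\max(\theta)$-reset is applied on this path. For a proof $\Pi'$, $\mathrm{strip}(\Pi')$ is the $\mathcal R$-preproof obtained by deleting all boards and contracting every application of a structural rule to one node. *Unfoldings* of a preproof $\Pi$ are preproofs each of whose nodes is a copy of a node of $\Pi$: $\Pi$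 is an unfolding of itself, and from an unfolding $\Pi_1$ with tree $T_1$ one gets another one by unfolding $\Pi_1$ at a bud $t$ with companion $c$: the tree becomes $T_1\cup\{tu\mid cu\in T_1\}$, the node $tu$ has the sequent and rule of $cu$, is a copy of the same node of $\Pi$ as $cu$, and is a bud iff $cu$ is; everything else stays unchanged at the nodes of $T_1\setminus\{t\}$. If $tu$ is a bud that is a copy of the bud $s$ of $\Pi$, its companion may be any proper prefix of $tu$ that is a copy of the companion of $s$ in $\Pi$. **Theorem (Completeness).** Let $\iota$ be a trace interpretation of $\mathcal R$ in $\mathcal T_{\mathcal A}$ and let $\Pi$ be a cyclic proof of $\Gamma$ in $\mathcal R$ with respect to $\iota$. Then there is a proof $\Pi'$ of $\Gamma;(\emptyset,(x,a)\mapsto\emptyset)$ in $\mathrm R(\mathcal R)$ such that $\mathrm{strip}(\Pi')$ is an unfolding of $\Pi$. -/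

import Mathlib

open CategoryTheory

namespace CyclicReset

universe u v w a c

/-! ### Derivation systems, cyclic trees, preproofs and cyclic proof systems -/

/-- A derivation system: every rule has a conclusion and finitely many (ordered) premises. -/
structure DerivationSystem where
  Seq : Type u
  Rule : Type v
  concl : Rule → Seq
  arity : Rule → ℕ
  prem : (r : Rule) → Fin (arity r) → Seq

/-- A finite tree of words over `ℕ` (the children of `t` are the words `t ++ [i]` of the tree)
with a partial function `back` that sends some leaves (the buds) to proper prefixes
(their companions, which are inner nodes of the tree). -/
structure CyclicTree where
  tree : Set (List ℕ)
  finite : tree.Finite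
  root_mem : [] ∈ tree
  prefix_closed : ∀ s t, s <+: t → t ∈ tree → s ∈ tree
  back : List ℕ → Option (List ℕ)
  bud_leaf : ∀ t c, back t = some c → t ∈ tree ∧ ∀ i : ℕ, t ++ [i] ∉ tree
  companion_lt : ∀ t c, back t = some c → c <+: t ∧ c ≠ t

/-- The leaves of a cyclic tree. -/
def CyclicTree.Leaf (T : CyclicTree) (t : List ℕ) : Prop :=
  t ∈ T.tree ∧ ∀ i : ℕ, t ++ [i] ∉ T.tree

/-- Preproofs. The values of `label` outside of the tree carry no information. -/
structure Preproof (D : DerivationSystem) extends CyclicTree where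
  label : List ℕ → D.Seq
  rule : List ℕ → Option D.Rule
  label_back : ∀ t c, back t = some c → label t = label c
  rule_dom : ∀ t r, rule t = some r → t ∈ tree ∧ back t = none
  rule_concl : ∀ t r, rule t = some r → label t = D.concl r
  rule_children : ∀ t r, rule t = some r → ∀ i : ℕ, t ++ [i] ∈ tree ↔ i < D.arity r
  rule_prem : ∀ t r, rule t = some r → ∀ i : Fin (D.arity r), label (t ++ [i.val]) = D.prem r i
  leaf_of_no_rule : ∀ t ∈ tree, rule t = none → ∀ i : ℕ, t ++ [i] ∉ tree

/-- The endsequent of a preproof. -/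
def Preproof.endsequent {D : DerivationSystem} (P : Preproof D) : D.Seq := P.label []

/-- A preproof without assumptions: every node which is not a bud is the conclusion of a rule. -/
def Preproof.Closed {D : DerivationSystem} (P : Preproof D) : Prop :=
  ∀ t ∈ P.tree, P.back t = none → ∃ r, P.rule t = some r

/-- A cyclic proof system: a derivation system with a set of preproofs without assumptions. -/
structure CyclicProofSystem where
  sys : DerivationSystem.{u, v}
  proofs : Set (Preproof sys)
  closed : ∀ P ∈ proofs, P.Closed

/-! ### Activation algebras and the trace category they induce -/

/-- An activation algebra: a finite join-semilattice with least element `⊥` and a fixed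
activation element different from `⊥`. -/
class ActivationAlgebra (A : Type*) extends SemilatticeSup A, OrderBot A where
  finite : Finite A
  act : A
  act_ne_bot : act ≠ ⊥

/-- The objects of the `A`-activated trace category: finite sets. -/
structure TraceCat (A : Type a) where
  carrier : Type w
  finite : Finite carrier

/-- The morphisms of the `A`-activated trace category: subsets of `X × A × Y`. -/
@[ext]
structure TraceHom {A : Type a} (X Y : TraceCat.{w} A) where
  rel : Set (X.carrier × A × Y.carrier)

instance {A : Type*} [ActivationAlgebra A] : Category (TraceCat A) where
  Hom X Y := TraceHom X Y
  id X := ⟨{q | q.1 = q.2.2 ∧ q.2.1 = ⊥}⟩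
  comp {_ Y _} R R' := ⟨{q | ∃ (y : Y.carrier) (a b : A),
    (q.1, a, y) ∈ R.rel ∧ (y, b, q.2.2) ∈ R'.rel ∧ a ⊔ b = q.2.1}⟩
  id_comp {X Y} R := by
    apply TraceHom.ext
    ext ⟨x, c, z⟩
    constructor
    · rintro ⟨y, a, b, ⟨h1, h2⟩, h3, h4⟩
      dsimp only at h1 h2 h4
      subst h1 h2 h4
      simpa using h3
    · intro h
      exact ⟨x, ⊥, c, ⟨rfl, rfl⟩, h, by simp⟩
  comp_id {X Y} R := by
    apply TraceHom.ext
    ext ⟨x, c, z⟩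
    constructor
    · rintro ⟨y, a, b, h3, ⟨h1, h2⟩, h4⟩
      dsimp only at h1 h2 h4
      subst h1 h2 h4
      simpa using h3
    · intro h
      exact ⟨z, c, ⊥, h, ⟨rfl, rfl⟩, by simp⟩
  assoc {W X Y Z} R S T := by
    apply TraceHom.ext
    ext ⟨w, e, z⟩
    constructor
    · rintro ⟨y, a, b, ⟨x, c, d, h1, h2, h3⟩, h4, h5⟩
      exact ⟨x, c, d ⊔ b, h1, ⟨y, d, b, h2, h4, rfl⟩, by
        dsimp only at h3 h5 ⊢
        rw [← h5, ← h3, sup_assoc]⟩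
    · rintro ⟨x, a, b, h1, ⟨y, c, d, h2, h3, h4⟩, h5⟩
      exact ⟨y, a ⊔ c, d, ⟨x, a, c, h1, h2, rfl⟩, h3, by
        dsimp only at h4 h5 ⊢
        rw [← h5, ← h4, sup_assoc]⟩

/-- The trace condition on a path `P : ℕ ⥤ TraceCat A`: along the subpath of `P` given by some
strictly monotone `S`, there is a sequence of elements in which consecutive elements are
related with the activation element. -/
def TraceCondition {A : Type*} [ActivationAlgebra A] (P : ℕ ⥤ TraceCat A) : Prop :=
  ∃ (S : ℕ → ℕ) (hS : StrictMono S) (x : (i : ℕ) → (P.obj (S i)).carrier),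
    ∀ i, (x i, ActivationAlgebra.act, x (i + 1)) ∈
      TraceHom.rel (P.map (homOfLE (hS.monotone (Nat.le_succ i))))

/-- A trace interpretation of a derivation system in the `A`-activated trace category. -/
structure TraceInterpretation (D : DerivationSystem.{u, v}) (A : Type a) [ActivationAlgebra A] where
  obj : D.Seq → TraceCat.{w} A
  mor : (r : D.Rule) → (i : Fin (D.arity r)) → (obj (D.concl r) ⟶ obj (D.prem r i))

/-- `π` is a branch through the cyclic tree `T`. -/
def CyclicTree.IsBranch (T : CyclicTree) (π : ℕ → List ℕ) : Prop :=
  π 0 = [] ∧ ∀ n,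
    (¬ T.Leaf (π n) → π (n + 1) ∈ T.tree ∧ ∃ i : ℕ, π (n + 1) = π n ++ [i]) ∧
    (T.Leaf (π n) → T.back (π n) = some (π (n + 1)))

/-- The morphism induced by the step from the node `s` to the node `t`: the morphism of the
`i`-th premise of the rule at `s` if `t` is the `i`-th child of `s`, and the identity if `s` is
a bud with companion `t` (both up to the equalities between the sequents involved). -/
def stepHom {D : DerivationSystem.{u, v}} {A : Type a} [ActivationAlgebra A]
    (I : TraceInterpretation.{u, v, w} D A) (P : Preproof D) (s t : List ℕ) :
    I.obj (P.label s) ⟶ I.obj (P.label t) :=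
  TraceHom.mk {q |
    (∃ (r : D.Rule) (i : Fin (D.arity r))
        (hs : P.label s = D.concl r) (ht : D.prem r i = P.label t),
      P.rule s = some r ∧ t = s ++ [i.val] ∧
      q ∈ TraceHom.rel (eqToHom (congrArg I.obj hs) ≫ I.mor r i ≫ eqToHom (congrArg I.obj ht))) ∨
    (∃ h : P.label s = P.label t, P.back s = some t ∧
      q ∈ TraceHom.rel (eqToHom (congrArg I.obj h)))}

/-- The path through the trace category induced by a sequence of nodes of a preproof. -/
def inducedPath {D : DerivationSystem.{u, v}} {A : Type a} [ActivationAlgebra A]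
    (I : TraceInterpretation.{u, v, w} D A) (P : Preproof D) (π : ℕ → List ℕ) : ℕ ⥤ TraceCat A :=
  Functor.ofSequence (X := fun n => I.obj (P.label (π n)))
    (fun n => stepHom I P (π n) (π (n + 1)))

/-- The cyclic proof system induced by a trace interpretation: its proofs are the preproofs
without assumptions all of whose branches satisfy the trace condition. -/
def inducedSystem {D : DerivationSystem.{u, v}} {A : Type a} [ActivationAlgebra A]
    (I : TraceInterpretation.{u, v, w} D A) : CyclicProofSystem where
  sys := D
  proofs := {P | P.Closed ∧ ∀ π, P.IsBranch π → TraceCondition (inducedPath I P π)}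
  closed := fun _ h => h.1

/-! ### Safra boards -/

/-- Safra boards on `A` and the object `X` with chips from `C`. The control, a finite linear
order on a set of chips, is given as the list of its chips in increasing order.
A stack is a set of chips of the control. -/
structure Board {A : Type a} (C : Type c) (X : TraceCat.{w} A) where
  control : List C
  nodup : control.Nodup
  stackSet : X.carrier → A → Set (Set C)
  stack_sub : ∀ x a, ∀ S ∈ stackSet x a, ∀ γ ∈ S, γ ∈ control
  occurs : ∀ γ ∈ control, ∃ x a, ∃ S ∈ stackSet x a, γ ∈ S

namespace Board

variable {A : Type*} {C : Type*} {X Y : TraceCat A}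

/-- The board with empty control and without stacks. -/
def empty (C : Type*) (X : TraceCat A) : Board C X where
  control := []
  nodup := List.nodup_nil
  stackSet := fun _ _ => ∅
  stack_sub := by simp
  occurs := by simp

/-- The strict order of the control: `γ` occurs before `δ`. -/
def Lt (b : Board C X) (γ δ : C) : Prop := [γ, δ].Sublist b.control

/-- `γ` is the top of the stack `S`. -/
def IsTop (b : Board C X) (γ : C) (S : Set C) : Prop :=
  γ ∈ S ∧ ∀ δ ∈ S, δ = γ ∨ b.Lt δ γ

/-- The chip `γ` is covered: it is not on top of any stack. -/
def Covered (b : Board C X) (γ : C) : Prop :=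
  γ ∈ b.control ∧ ∀ x a, ∀ S ∈ b.stackSet x a, ¬ b.IsTop γ S

/-- `b'` is a weakening of `b`; the control of `b'` is a suborder of that of `b`. -/
def Weakening (b b' : Board C X) : Prop :=
  b'.control.Sublist b.control ∧ ∀ x a, b'.stackSet x a ⊆ b.stackSet x a

/-- The `γ`-reset of a stack `S`: if `γ ∈ S`, all chips above `γ` are removed. -/
def resetStack (b : Board C X) (γ : C) (S : Set C) : Set C :=
  {z | z ∈ S ∧ (γ ∈ S → z = γ ∨ b.Lt z γ)}

/-- `b'` is the `γ`-reset of `b`. As every board, `b'` has exactly those chips in its control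
which occur in one of its stacks. -/
def Reset (γ : C) (b b' : Board C X) : Prop :=
  b.Covered γ ∧ b'.control.Sublist b.control ∧
    ∀ x a, b'.stackSet x a = b.resetStack γ '' b.stackSet x a

/-- `b'` is a population of `b`. -/
def Population [ActivationAlgebra A] (b b' : Board C X) : Prop :=
  b'.control = b.control ∧
    (∀ x, b.stackSet x ⊥ ⊆ b'.stackSet x ⊥ ∧ b'.stackSet x ⊥ ⊆ b.stackSet x ⊥ ∪ {∅}) ∧
    ∀ x a, a ≠ ⊥ → b'.stackSet x a = b.stackSet x a

/-- The stacks after moving the stacks of `b` along `τ`. -/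
def moved [ActivationAlgebra A] (τ : X ⟶ Y) (b : Board C X) (y : Y.carrier) (a : A) :
    Set (Set C) :=
  {S | ∃ (x : X.carrier) (e c : A),
    S ∈ b.stackSet x e ∧ (x, c, y) ∈ TraceHom.rel τ ∧ a = e ⊔ c}

/-- `b'` is a `τ`-successor of `b`: the stacks are moved along `τ` (which leaves the suborder
`old` of the control of `b`), and the stacks that have landed on a position `(y, act)` are moved
to `(y, ⊥)` with a fresh chip `ι y` on top of each of them; the fresh chips `fresh` are put above
the old ones. -/
def Successor [ActivationAlgebra A] (τ : X ⟶ Y) (b : Board C X) (b' : Board C Y) : Prop :=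
  ∃ (old fresh : List C) (ι : Y.carrier → C),
    old.Sublist b.control ∧
    (∀ γ, γ ∈ old ↔ γ ∈ b.control ∧ ∃ y a, ∃ S ∈ moved τ b y a, γ ∈ S) ∧
    (∀ γ ∈ fresh, γ ∉ b.control) ∧
    Set.BijOn ι {y | (moved τ b y ActivationAlgebra.act).Nonempty} {γ | γ ∈ fresh} ∧
    b'.control = old ++ fresh ∧
    (∀ y, b'.stackSet y ActivationAlgebra.act = ∅) ∧
    (∀ y, b'.stackSet y ⊥ =
      moved τ b y ⊥ ∪ {S' | ∃ S ∈ moved τ b y ActivationAlgebra.act, S' = S ∪ {ι y}}) ∧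
    (∀ y a, a ≠ ActivationAlgebra.act → a ≠ ⊥ → b'.stackSet y a = moved τ b y a)

end Board

/-! ### The reset proof system -/

/-- The rules of the reset proof system: weakening, reset, population, and the rules of `D`
annotated with boards. -/
inductive ResetRule {D : DerivationSystem.{u, v}} {A : Type a} [ActivationAlgebra A] (C : Type c)
    (I : TraceInterpretation.{u, v, w} D A)
  | weak (Γ : D.Seq) (b b' : Board C (I.obj Γ)) (h : Board.Weakening b b')
  | reset (γ : C) (Γ : D.Seq) (b b' : Board C (I.obj Γ)) (h : Board.Reset γ b b')
  | pop (Γ : D.Seq) (b b' : Board C (I.obj Γ)) (h : Board.Population b b')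
  | app (r : D.Rule) (b : Board C (I.obj (D.concl r)))
      (bs : (i : Fin (D.arity r)) → Board C (I.obj (D.prem r i)))
      (h : ∀ i, Board.Successor (I.mor r i) b (bs i))

/-- The derivation system of the reset proof system: its sequents `⟨Γ, b⟩` are sequents `Γ` of
`D` annotated with a Safra board on the trace object of `Γ`. -/
def resetDerivation {D : DerivationSystem.{u, v}} {A : Type a} [ActivationAlgebra A] (C : Type c)
    (I : TraceInterpretation.{u, v, w} D A) : DerivationSystem where
  Seq := Σ Γ : D.Seq, Board C (I.obj Γ)
  Rule := ResetRule C I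
  concl
    | .weak Γ b _ _ => ⟨Γ, b⟩
    | .reset _ Γ b _ _ => ⟨Γ, b⟩
    | .pop Γ b _ _ => ⟨Γ, b⟩
    | .app r b _ _ => ⟨D.concl r, b⟩
  arity
    | .weak _ _ _ _ => 1
    | .reset _ _ _ _ _ => 1
    | .pop _ _ _ _ => 1
    | .app r _ _ _ => D.arity r
  prem
    | .weak Γ _ b' _ => fun _ => ⟨Γ, b'⟩
    | .reset _ Γ _ b' _ => fun _ => ⟨Γ, b'⟩
    | .pop Γ _ b' _ => fun _ => ⟨Γ, b'⟩
    | .app r _ bs _ => fun i => ⟨D.prem r i, bs i⟩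

section Reset

variable {D : DerivationSystem.{u, v}} {A : Type a} [ActivationAlgebra A] {C : Type c}
  {I : TraceInterpretation.{u, v, w} D A}

/-- `θ` is an invariant of the path from the companion `c` to the bud `t`: it is a prefix of all
controls on the path, and its greatest chip is reset on the path. -/
def IsInvariant (P : Preproof (resetDerivation C I)) (c t : List ℕ) (θ : List C) : Prop :=
  (∀ s, c <+: s → s <+: t → θ <+: (P.label s).2.control) ∧
  ∃ γ, θ.getLast? = some γ ∧
    ∃ s, c <+: s ∧ s <+: t ∧ s ≠ t ∧
      ∃ (Γ : D.Seq) (b b' : Board C (I.obj Γ)) (h : Board.Reset γ b b'),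
        P.rule s = some (ResetRule.reset γ Γ b b' h)

end Reset

/-- The reset proof system: its proofs are the preproofs without assumptions such that the path
between any bud and its companion has an invariant. -/
def resetSystem {D : DerivationSystem.{u, v}} {A : Type a} [ActivationAlgebra A] (C : Type c)
    (I : TraceInterpretation.{u, v, w} D A) : CyclicProofSystem where
  sys := resetDerivation C I
  proofs := {P | P.Closed ∧ ∀ t c, P.back t = some c → ∃ θ, IsInvariant P c t θ}
  closed := fun _ h => h.1

/-! ### Stripping annotations -/

section Strip

variable {D : DerivationSystem.{u, v}} {A : Type a} [ActivationAlgebra A] {C : Type c}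
  {I : TraceInterpretation.{u, v, w} D A}

/-- The structural rules: weakening, reset and population. -/
def ResetRule.IsStructural : ResetRule C I → Prop
  | .weak _ _ _ _ => True
  | .reset _ _ _ _ _ => True
  | .pop _ _ _ _ => True
  | .app _ _ _ _ => False

open Classical in
/-- The word `u` without those letters that lead from a node at which a structural rule is
applied to its child, if `u` is read as a path downwards from the node `s`. -/
noncomputable def stripFrom (P : Preproof (resetDerivation C I)) :
    (s : List ℕ) → (u : List ℕ) → List ℕ
  | _, [] => []
  | s, i :: u =>
    if ∃ r : ResetRule C I, P.rule s = some r ∧ r.IsStructural then stripFrom P (s ++ [i]) u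
    else i :: stripFrom P (s ++ [i]) u

/-- The node of the stripped preproof that corresponds to the node `t` of `P`. -/
noncomputable def stripNode (P : Preproof (resetDerivation C I)) (t : List ℕ) : List ℕ :=
  stripFrom P [] t

/-- `Q` is the preproof `strip(P)`: the boards are removed from all sequents, every annotated rule
is replaced by the underlying rule of `D`, and every application of a structural rule is replaced
by the trivial preproof, i.e. its premise and its conclusion become one node. -/
structure IsStrip (P : Preproof (resetDerivation C I)) (Q : Preproof D) : Prop where
  tree : Q.tree = stripNode P '' P.tree
  label : ∀ t ∈ P.tree, Q.label (stripNode P t) = (P.label t).1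
  rule : ∀ s r, Q.rule s = some r ↔ ∃ t b bs h, stripNode P t = s ∧
    P.rule t = some (ResetRule.app r b bs h)
  back : ∀ s d, Q.back s = some d ↔ ∃ t c, stripNode P t = s ∧ stripNode P c = d ∧
    P.back t = some c

end Strip

/-! ### Unfoldings -/

/-- `P₂` arises from the unfolding `P₁` of `P` by unfolding it at the bud `t`: a copy of the
subtree of `P₁` at the companion `c` of `t` is put at `t`. The maps `p₁` and `p₂` send each node of
`P₁` and `P₂` to the node of `P` of which it is a copy. The companion of a copied bud may be
any copy, among its proper prefixes, of the companion that it has in `P`. -/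
structure UnfoldStep {D : DerivationSystem} (P P₁ : Preproof D) (p₁ : List ℕ → List ℕ)
    (t c : List ℕ) (P₂ : Preproof D) (p₂ : List ℕ → List ℕ) : Prop where
  bud : P₁.back t = some c
  tree : P₂.tree = P₁.tree ∪ {s | ∃ u, s = t ++ u ∧ c ++ u ∈ P₁.tree}
  label_old : ∀ s ∈ P₁.tree, s ≠ t → P₂.label s = P₁.label s
  rule_old : ∀ s ∈ P₁.tree, s ≠ t → P₂.rule s = P₁.rule s
  back_old : ∀ s ∈ P₁.tree, s ≠ t → P₂.back s = P₁.back s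
  proj_old : ∀ s ∈ P₁.tree, s ≠ t → p₂ s = p₁ s
  label_new : ∀ u, c ++ u ∈ P₁.tree → P₂.label (t ++ u) = P₁.label (c ++ u)
  rule_new : ∀ u, c ++ u ∈ P₁.tree → P₂.rule (t ++ u) = P₁.rule (c ++ u)
  proj_new : ∀ u, c ++ u ∈ P₁.tree → p₂ (t ++ u) = p₁ (c ++ u)
  bud_new : ∀ u, c ++ u ∈ P₁.tree → (P₂.back (t ++ u) = none ↔ P₁.back (c ++ u) = none)
  back_new : ∀ u d, c ++ u ∈ P₁.tree → P₂.back (t ++ u) = some d →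
    P.back (p₂ (t ++ u)) = some (p₂ d)

/-- `P₁` is arrived at by repeatedly unfolding `P`, where `p₁` sends each node of `P₁` to the
node of `P` of which it is a copy. -/
inductive UnfoldsTo {D : DerivationSystem} (P : Preproof D) :
    Preproof D → (List ℕ → List ℕ) → Prop
  | refl : UnfoldsTo P P id
  | step {P₁ P₂ : Preproof D} {p₁ p₂ : List ℕ → List ℕ} {t c : List ℕ} :
      UnfoldsTo P P₁ p₁ → UnfoldStep P P₁ p₁ t c P₂ p₂ → UnfoldsTo P P₂ p₂

/-- `Q` is an unfolding of `P`. -/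
def IsUnfolding {D : DerivationSystem} (P Q : Preproof D) : Prop := ∃ p, UnfoldsTo P Q p

end CyclicReset

namespace CyclicReset

/-! ### Positions in lists without duplicates -/

section Lists

variable {C : Type*} [DecidableEq C]

/-! The infinite unfolding of `P` is annotated with boards by a fixed strategy, starting with the
empty board at the root. At each node the board is populated, only the lexicographically best stack
is kept at each position, and covered chips are reset until none is left. Then every chip is the top
of the only stack at some position, so the control has at most as many chips as there are positions,
and a fixed finite set `F` of chips can supply all fresh ones. Hence finitely many boards occur, and
one number `k` of structural steps serves all nodes (`tidy_coveredChip`, `length_control_tidy`,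
`exists_successor`).

On an infinite branch the trace condition yields a thread. Population puts an empty stack on it, and
this stack, or a better one that replaces it, follows the thread and receives a fresh chip
infinitely often. Suppose that no chip stays in the control and is reset infinitely often. When the
chips that stay in the stack forever have settled, consider the lowest position that any other chip
of the stack ever takes. Losing the chip there requires a lower one to be gained or reset, which is
impossible; so it stays forever after all, a contradiction (`exists_persistent_reset`). Thus some
chip stays in the control and is reset infinitely often. Fresh chips enter above all others, so the
part of the control up to this chip only shrinks and is eventually a constant `θ`
(`exists_stable_prefix`).

By the pigeonhole principle every late node repeats the state of an earlier one, with `θ` a prefix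
of all controls and a reset of its greatest chip in between; this earlier node is a good companion
(`Suffices.exists_isGood`). By Kőnig's lemma, unfolding at bad buds and choosing good companions
whenever they exist comes to an end (`exists_good_unfolding`). The resulting unfolding, annotated
with the boards, is a reset proof (`annotate_mem_proofs`), and stripping gives the unfolding back
(`isStrip_annotate`). -/

theorem pair_sublist_of_idxOf_lt {l : List C} {x y : C} (hy : y ∈ l)
    (h : l.idxOf x < l.idxOf y) : [x, y].Sublist l := by
  induction l with
  | nil => simp at hy
  | cons z l ih =>
    by_cases hzy : z = y
    · subst hzy; simp at h
    have hy' : y ∈ l := by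
      rcases List.mem_cons.1 hy with h' | h'
      · exact absurd h'.symm hzy
      · exact h'
    by_cases hzx : z = x
    · subst hzx
      exact List.Sublist.cons_cons _ (List.singleton_sublist.2 hy')
    · rw [List.idxOf_cons_ne _ hzy, List.idxOf_cons_ne _ hzx] at h
      exact List.Sublist.cons _ (ih hy' (by omega))

/-- Together with `pair_sublist_of_idxOf_lt`, this turns the order of a control, which `Board.Lt`
expresses by sublists, into a comparison of positions. -/
theorem idxOf_lt_of_pair_sublist {l : List C} (hl : l.Nodup) {x y : C}
    (h : [x, y].Sublist l) : l.idxOf x < l.idxOf y := by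
  induction l with
  | nil => simp at h
  | cons z l ih =>
    have hz := (List.nodup_cons.1 hl).1
    rcases h with _ | h | h
    · rename_i h
      have hx : x ∈ l := h.subset (by simp)
      have hy : y ∈ l := h.subset (by simp)
      rw [List.idxOf_cons_ne _ (by rintro rfl; exact hz hx),
        List.idxOf_cons_ne _ (by rintro rfl; exact hz hy)]
      have := ih (List.nodup_cons.1 hl).2 h
      omega
    · rename_i h
      have hy : y ∈ l := h.subset (by simp)
      have hne : x ≠ y := by rintro rfl; exact hz hy
      simp [List.idxOf_cons_ne _ hne]

/-- The prefix of a list up to and including the first occurrence of `x`. -/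
def upTo (x : C) (l : List C) : List C := l.take (l.idxOf x + 1)

theorem upTo_prefix (x : C) (l : List C) : upTo x l <+: l := List.take_prefix _ _

theorem length_upTo {x : C} {l : List C} (h : x ∈ l) : (upTo x l).length = l.idxOf x + 1 := by
  have := List.idxOf_lt_length_iff.2 h
  simp only [upTo, List.length_take]
  omega

theorem getLast?_upTo {x : C} {l : List C} (h : x ∈ l) : (upTo x l).getLast? = some x := by
  have := List.idxOf_lt_length_iff.2 h
  rw [List.getLast?_eq_getElem?, length_upTo h]
  simp [upTo, List.getElem?_eq_getElem this]

theorem upTo_sublist {x : C} {l l' : List C} (h : l'.Sublist l) (hl : l.Nodup) (hx : x ∈ l') :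
    (upTo x l').Sublist (upTo x l) := by
  induction h with
  | slnil => simp at hx
  | cons z h ih =>
    rename_i l₁ l₂
    have hne : z ≠ x := fun e => (List.nodup_cons.1 hl).1 (e ▸ h.subset hx)
    have := ih (List.nodup_cons.1 hl).2 hx
    simp only [upTo, List.idxOf_cons_ne _ hne, List.take_succ_cons] at this ⊢
    exact this.cons _
  | cons_cons z h ih =>
    by_cases hne : z = x
    · subst hne; simp [upTo]
    · have := ih (List.nodup_cons.1 hl).2 (by simpa [Ne.symm hne] using hx)
      simp only [upTo, List.idxOf_cons_ne _ hne, List.take_succ_cons] at this ⊢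
      exact this.cons_cons _

theorem idxOf_le_of_sublist {x : C} {l l' : List C} (h : l'.Sublist l) (hl : l.Nodup)
    (hx : x ∈ l') : l'.idxOf x ≤ l.idxOf x := by
  have := (upTo_sublist h hl hx).length_le
  rw [length_upTo hx, length_upTo (h.subset hx)] at this
  omega

/-- One step in the evolution of a control: some elements are removed, and then new ones are
appended. -/
def ControlStep (l l' : List C) : Prop :=
  ∃ old fresh : List C, l' = old ++ fresh ∧ old.Sublist l ∧ ∀ x ∈ fresh, x ∉ l

omit [DecidableEq C] in
theorem ControlStep.of_sublist {l l' : List C} (h : l'.Sublist l) : ControlStep l l' :=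
  ⟨l', [], by simp, h, by simp⟩

/-- New elements are appended at the end, so below a surviving chip a control can only lose chips.
-/
theorem ControlStep.upTo_sublist {l l' : List C} (h : ControlStep l l') (hl : l.Nodup) {x : C}
    (hx : x ∈ l) (hx' : x ∈ l') : (upTo x l').Sublist (upTo x l) := by
  obtain ⟨old, fresh, rfl, ho, hf⟩ := h
  have hxo : x ∈ old := by
    rcases List.mem_append.1 hx' with h | h
    · exact h
    · exact absurd hx (hf x h)
  have : upTo x (old ++ fresh) = upTo x old := by
    have := List.idxOf_lt_length_iff.2 hxo
    rw [upTo, upTo, List.idxOf_append_of_mem hxo, List.take_append_of_le_length (by omega)]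
  rw [this]
  exact CyclicReset.upTo_sublist ho hl hxo

theorem ControlStep.idxOf_le {l l' : List C} (h : ControlStep l l') (hl : l.Nodup) {x : C}
    (hx : x ∈ l) (hx' : x ∈ l') : l'.idxOf x ≤ l.idxOf x := by
  have := (h.upTo_sublist hl hx hx').length_le
  rw [length_upTo hx, length_upTo hx'] at this
  omega

/-- The prefix up to a chip that stays in the control forever is eventually constant. -/
theorem exists_stable_prefix (l : ℕ → List C) (hl : ∀ n, (l n).Nodup)
    (hstep : ∀ n, ControlStep (l n) (l (n + 1))) {x : C} {n₀ : ℕ} (hx : ∀ n ≥ n₀, x ∈ l n) :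
    ∃ θ : List C, θ.getLast? = some x ∧ ∃ N, ∀ n ≥ N, θ <+: l n := by
  classical
  -- From `n₀` on, each prefix up to `x` is a sublist of the one before. Once the length is minimal,
  -- the prefix no longer changes.
  obtain ⟨N, hN, hmin⟩ : ∃ N ≥ n₀, ∀ n ≥ n₀, (upTo x (l N)).length ≤ (upTo x (l n)).length := by
    have hex : ∃ v, ∃ N ≥ n₀, (upTo x (l N)).length = v := ⟨_, n₀, le_rfl, rfl⟩
    obtain ⟨N, hN, hv⟩ := Nat.find_spec hex
    exact ⟨N, hN, fun n hn => hv ▸ Nat.find_min' hex ⟨n, hn, rfl⟩⟩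
  refine ⟨upTo x (l N), getLast?_upTo (hx N hN), N, fun n hn => ?_⟩
  have : upTo x (l n) = upTo x (l N) := by
    induction n, hn using Nat.le_induction with
    | base => rfl
    | succ n hn ih =>
      have hsub := (hstep n).upTo_sublist (hl n) (hx n (by omega)) (hx (n + 1) (by omega))
      rw [← ih]
      refine hsub.eq_of_length_le ?_
      rw [ih]
      exact hmin _ (by omega)
  rw [← this]
  exact upTo_prefix _ _

/-! ### Stacks along a sequence of controls -/

/-- The development of a stack `S` in a step of the control: a chip is only lost if a smaller
chip is gained or if a smaller chip in `S` is reset. -/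
def StackStep (l l' : List C) (o : Option C) (S S' : Set C) : Prop :=
  ∀ m ∈ S, m ∉ S' → (∃ γ ∈ S', γ ∉ S ∧ l'.idxOf γ < l.idxOf m) ∨
    ∃ γ ∈ S, o = some γ ∧ l.idxOf γ < l.idxOf m

/-- In every nonempty family of stacks there is one which is best in the lexicographic order. -/
theorem exists_best_stack (l : List C) (F : Set (Set C)) (hF : F.Nonempty) :
    ∃ S ∈ F, ∀ S' ∈ F, ∀ m ∈ l, m ∈ S' → m ∉ S → ∃ γ ∈ S, γ ∉ S' ∧ l.idxOf γ < l.idxOf m := by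
  induction l generalizing F with
  | nil => obtain ⟨S, hS⟩ := hF; exact ⟨S, hS, by simp⟩
  | cons z l ih =>
    have key : ∀ S S' : Set C, (z ∈ S' → z ∈ S) →
        (z ∈ S ∧ z ∉ S' ∨
          ∀ m ∈ l, m ∈ S' → m ∉ S → ∃ γ ∈ S, γ ∉ S' ∧ l.idxOf γ < l.idxOf m) →
        ∀ m ∈ z :: l, m ∈ S' → m ∉ S →
          ∃ γ ∈ S, γ ∉ S' ∧ (z :: l).idxOf γ < (z :: l).idxOf m := by
      intro S S' hz h m hm hmS' hmS
      have hne : z ≠ m := by rintro rfl; exact hmS (hz hmS')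
      rcases h with ⟨h1, h2⟩ | h
      · exact ⟨z, h1, h2, by simp [List.idxOf_cons_ne _ hne]⟩
      · obtain ⟨γ, h1, h2, h3⟩ := h m (by simpa [Ne.symm hne] using hm) hmS' hmS
        refine ⟨γ, h1, h2, ?_⟩
        rw [List.idxOf_cons_ne _ hne]
        by_cases hzγ : z = γ
        · subst hzγ; simp
        · rw [List.idxOf_cons_ne _ hzγ]; omega
    -- The head `z` decides first: if some stack contains it, only the stacks that contain it
    -- compete further.
    by_cases hz : ∃ S ∈ F, z ∈ S
    · obtain ⟨S₀, hS₀, hzS₀⟩ := hz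
      obtain ⟨S, ⟨hS, hzS⟩, hbest⟩ := ih {S | S ∈ F ∧ z ∈ S} ⟨S₀, hS₀, hzS₀⟩
      refine ⟨S, hS, fun S' hS' => key S S' (fun _ => hzS) ?_⟩
      by_cases hzS' : z ∈ S'
      · exact Or.inr (hbest S' ⟨hS', hzS'⟩)
      · exact Or.inl ⟨hzS, hzS'⟩
    · obtain ⟨S, hS, hbest⟩ := ih F hF
      exact ⟨S, hS, fun S' hS' => key S S' (fun h => absurd ⟨S', hS', h⟩ hz)
        (Or.inr (hbest S' hS'))⟩

/-- A sequence of stacks which grows infinitely often within a finite set of chips contains a chip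
which is eventually always present and infinitely often reset. -/
theorem exists_persistent_reset (l : ℕ → List C) (hl : ∀ n, (l n).Nodup)
    (hstep : ∀ n, ControlStep (l n) (l (n + 1))) (F : Set C) (hF : F.Finite)
    (hlF : ∀ n, ∀ γ ∈ l n, γ ∈ F) (o : ℕ → Option C) (S : ℕ → Set C)
    (hS : ∀ n, ∀ γ ∈ S n, γ ∈ l n)
    (hSS : ∀ n, StackStep (l n) (l (n + 1)) (o n) (S n) (S (n + 1)))
    (hgrow : ∀ N, ∃ n ≥ N, ∃ f ∈ S (n + 1), f ∉ l n) :
    ∃ γ, (∃ N, ∀ n ≥ N, γ ∈ l n) ∧ ∀ N, ∃ n ≥ N, o n = some γ := by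
  classical
  by_contra hcon
  push Not at hcon
  -- `V` consists of the chips that stay in the stack from some time on. From the `N` obtained
  -- below, all of them are present and none is reset.
  let V : Set C := {γ | ∃ N, ∀ n ≥ N, γ ∈ S n}
  have hVF : V.Finite := hF.subset fun γ ⟨N, hN⟩ => hlF N γ (hS N γ (hN N le_rfl))
  have hV : ∀ γ ∈ V, ∀ᶠ n in Filter.atTop, γ ∈ S n ∧ o n ≠ some γ := by
    rintro γ ⟨N, hN⟩
    obtain ⟨N', hN'⟩ := hcon γ ⟨N, fun n hn => hS n γ (hN n hn)⟩
    filter_upwards [Filter.eventually_ge_atTop N, Filter.eventually_ge_atTop N'] with n h1 h2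
    exact ⟨hN n h1, hN' n h2⟩
  obtain ⟨N, hN⟩ := Filter.eventually_atTop.1 ((Filter.eventually_all_finite hVF).2 hV)
  -- The aim is a chip outside `V` at the lowest position that ever occurs from `N` on. A fresh chip
  -- shows that candidates exist: it was missing from the control when all of `V` was already
  -- present.
  have hex : ∃ v, ∃ n ≥ N, ∃ m ∈ S n, m ∉ V ∧ (l n).idxOf m = v := by
    obtain ⟨n, hn, f, hf, hfn⟩ := hgrow N
    exact ⟨_, n + 1, by omega, f, hf, fun h => hfn (hS n f (hN n hn f h).1), rfl⟩
  obtain ⟨n, hn, m, hm, hmV, hv⟩ := Nat.find_spec hex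
  have hmin : ∀ k ≥ N, ∀ m' ∈ S k, m' ∉ V → (l n).idxOf m ≤ (l k).idxOf m' :=
    fun k hk m' h1 h2 => hv ▸ Nat.find_min' hex ⟨k, hk, m', h1, h2, rfl⟩
  refine hmV ⟨n, fun k hk => And.left (b := (l k).idxOf m ≤ (l n).idxOf m) ?_⟩
  induction k, hk using Nat.le_induction with
  | base => exact ⟨hm, le_rfl⟩
  | succ k hk ih =>
    obtain ⟨ih1, ih2⟩ := ih
    have hmem : m ∈ S (k + 1) := by
      -- Losing `m` requires a lower chip to be gained or reset. Such a chip is outside `V`, against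
      -- the minimality of the position.
      by_contra hnot
      rcases hSS k m ih1 hnot with ⟨γ, h1, h2, h3⟩ | ⟨γ, h1, h2, h3⟩
      · have := hmin (k + 1) (by omega) γ h1 fun h => h2 (hN k (by omega) γ h).1
        omega
      · have := hmin k (by omega) γ h1 fun h => (hN k (by omega) γ h).2 h2
        omega
    exact ⟨hmem, ((hstep k).idxOf_le (hl k) (hS k m ih1) (hS _ m hmem)).trans ih2⟩

end Lists

/-! ### Operations on boards -/

namespace Board

variable {A : Type*} {C : Type*} {X Y : TraceCat A}

open Classical in
/-- The board with given stacks, where the control is a given list restricted to the chips that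
occur. -/
noncomputable def ofStacks (l : List C) (hl : l.Nodup) (σ : X.carrier → A → Set (Set C))
    (hσ : ∀ x a, ∀ S ∈ σ x a, ∀ γ ∈ S, γ ∈ l) : Board C X where
  control := l.filter fun γ => decide (∃ x a, ∃ S ∈ σ x a, γ ∈ S)
  nodup := hl.filter _
  stackSet := σ
  stack_sub x a S hS γ hγ := by
    simpa [hσ x a S hS γ hγ] using ⟨x, a, S, hS, hγ⟩
  occurs γ hγ := by simpa using (List.mem_filter.1 hγ).2

theorem ofStacks_control_sublist (l : List C) (hl : l.Nodup) (σ : X.carrier → A → Set (Set C))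
    (hσ : ∀ x a, ∀ S ∈ σ x a, ∀ γ ∈ S, γ ∈ l) : (ofStacks l hl σ hσ).control.Sublist l :=
  List.filter_sublist

/-- The population which adds the empty stack wherever this is possible. -/
def populate [ActivationAlgebra A] (b : Board C X) : Board C X where
  control := b.control
  nodup := b.nodup
  stackSet x a := b.stackSet x a ∪ {S | a = ⊥ ∧ S = ∅}
  stack_sub := by
    rintro x a S (hS | ⟨-, rfl⟩) γ hγ
    · exact b.stack_sub x a S hS γ hγ
    · exact hγ.elim
  occurs γ hγ := by
    obtain ⟨x, a, S, hS, h⟩ := b.occurs γ hγ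
    exact ⟨x, a, S, Or.inl hS, h⟩

theorem population_populate [ActivationAlgebra A] (b : Board C X) :
    b.Population b.populate := by
  refine ⟨rfl, fun x => ⟨fun S hS => Or.inl hS, ?_⟩, fun x a ha => ?_⟩
  · rintro S (hS | ⟨-, rfl⟩)
    · exact Or.inl hS
    · exact Or.inr rfl
  · ext S
    simp [populate, ha]

open Classical in
/-- The set which contains just the best stack of a family, if the family is nonempty. -/
def bestStacks (l : List C) (F : Set (Set C)) : Set (Set C) :=
  {S | ∃ h : F.Nonempty, S = Classical.choose (exists_best_stack l F h)}

theorem bestStacks_subset (l : List C) (F : Set (Set C)) : bestStacks l F ⊆ F := by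
  classical
  rintro S ⟨h, rfl⟩
  exact (Classical.choose_spec (exists_best_stack l F h)).1

theorem bestStacks_subsingleton (l : List C) (F : Set (Set C)) : (bestStacks l F).Subsingleton := by
  rintro S ⟨h, rfl⟩ S' ⟨h', rfl⟩
  rfl

/-- The weakening which keeps just the best stack at each position. -/
noncomputable def thin (b : Board C X) : Board C X :=
  ofStacks b.control b.nodup (fun x a => bestStacks b.control (b.stackSet x a))
    fun x a S hS => b.stack_sub x a S (bestStacks_subset _ _ hS)

theorem weakening_thin (b : Board C X) : b.Weakening b.thin :=
  ⟨ofStacks_control_sublist _ _ _ _, fun _ _ => bestStacks_subset _ _⟩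

-- The stack kept at a position is best there: for each chip that it lacks compared with a discarded
-- stack, it has a lower chip which that stack lacks. Deleting chips from the control does not raise
-- positions.
open Classical in
theorem exists_thin_stack (b : Board C X) {x : X.carrier} {a : A} {S : Set C}
    (hS : S ∈ b.stackSet x a) :
    ∃ S' ∈ b.thin.stackSet x a, StackStep b.control b.thin.control none S S' := by
  have hne : (b.stackSet x a).Nonempty := ⟨S, hS⟩
  obtain ⟨-, hbest⟩ := Classical.choose_spec (exists_best_stack b.control _ hne)
  have hmem : Classical.choose (exists_best_stack b.control _ hne) ∈ b.thin.stackSet x a :=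
    ⟨hne, rfl⟩
  refine ⟨_, hmem, fun m hm hm' => Or.inl ?_⟩
  obtain ⟨γ, h1, h2, h3⟩ := hbest S hS m (b.stack_sub x a S hS m hm) hm hm'
  exact ⟨γ, h1, h2, (idxOf_le_of_sublist (ofStacks_control_sublist _ _ _ _) b.nodup
    (b.thin.stack_sub _ _ _ hmem γ h1)).trans_lt h3⟩

/-- The `γ`-reset of a board. -/
noncomputable def resetAt (γ : C) (b : Board C X) : Board C X :=
  ofStacks b.control b.nodup (fun x a => b.resetStack γ '' b.stackSet x a) (by
    rintro x a _ ⟨S, hS, rfl⟩ δ hδ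
    exact b.stack_sub x a S hS δ hδ.1)

theorem reset_resetAt {γ : C} {b : Board C X} (h : b.Covered γ) : b.Reset γ (b.resetAt γ) :=
  ⟨h, ofStacks_control_sublist _ _ _ _, fun _ _ => rfl⟩

open Classical in
/-- Some covered chip, if there is one. -/
noncomputable def coveredChip (b : Board C X) : Option C :=
  if h : ∃ γ, b.Covered γ then some (Classical.choose h) else none

theorem covered_of_coveredChip {b : Board C X} {γ : C} (h : b.coveredChip = some γ) :
    b.Covered γ := by
  unfold coveredChip at h
  split_ifs at h with h'
  cases h
  exact Classical.choose_spec h'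

theorem coveredChip_eq_none {b : Board C X} : b.coveredChip = none ↔ ∀ γ, ¬ b.Covered γ := by
  unfold coveredChip
  split_ifs with h
  · simpa using h
  · simpa using h

/-- The board after the reset of some covered chip, if there is one. -/
noncomputable def resetOnce (b : Board C X) : Board C X :=
  match b.coveredChip with
  | some γ => b.resetAt γ
  | none => b

theorem resetOnce_of_some {b : Board C X} {γ : C} (h : b.coveredChip = some γ) :
    b.resetOnce = b.resetAt γ := by
  simp [resetOnce, h]

theorem resetOnce_of_none {b : Board C X} (h : b.coveredChip = none) : b.resetOnce = b := by
  simp [resetOnce, h]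

theorem Weakening.refl (b : Board C X) : b.Weakening b :=
  ⟨List.Sublist.refl _, fun _ _ => subset_rfl⟩

open Classical in
theorem StackStep.refl (l l' : List C) (o : Option C) (S : Set C) : StackStep l l' o S S :=
  fun _ h h' => absurd h h'

open Classical in
theorem stackStep_resetStack (b : Board C X) (γ : C) (hγ : γ ∈ b.control) (l' : List C) {S : Set C}
    (hS : ∀ δ ∈ S, δ ∈ b.control) :
    StackStep b.control l' (some γ) S (b.resetStack γ S) := by
  intro m hm hm'
  have h : ¬ (γ ∈ S → m = γ ∨ b.Lt m γ) := fun h => hm' ⟨hm, h⟩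
  push Not at h
  obtain ⟨h1, h2, h3⟩ := h
  refine Or.inr ⟨γ, h1, rfl, ?_⟩
  by_contra hlt
  refine h3 (pair_sublist_of_idxOf_lt hγ (lt_of_le_of_ne (not_lt.1 hlt) fun e => h2 ?_))
  exact (List.idxOf_inj (hS m hm)).1 e

/-- The boards that arise from `b` by population, weakening to the best stacks, and a series of
resets. -/
noncomputable def tidy [ActivationAlgebra A] (b : Board C X) : ℕ → Board C X
  | 0 => b
  | 1 => b.populate
  | 2 => b.populate.thin
  | j + 3 => (tidy b (j + 2)).resetOnce

/-- The chip which is reset in a step of `Board.tidy`. -/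
noncomputable def tidyChip [ActivationAlgebra A] (b : Board C X) : ℕ → Option C
  | 0 => none
  | 1 => none
  | j + 2 => (b.tidy (j + 2)).coveredChip

/-! ### Tidying up a board: one stack per position and no covered chips -/

section Tidy

variable [ActivationAlgebra A] (b : Board C X)

theorem tidy_step (j : ℕ) :
    (∃ γ, b.tidyChip j = some γ ∧ (b.tidy j).Reset γ (b.tidy (j + 1))) ∨
      b.tidyChip j = none ∧
        ((b.tidy j).Weakening (b.tidy (j + 1)) ∨ (b.tidy j).Population (b.tidy (j + 1))) := by
  match j with
  | 0 => exact Or.inr ⟨rfl, Or.inr b.population_populate⟩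
  | 1 => exact Or.inr ⟨rfl, Or.inl b.populate.weakening_thin⟩
  | j + 2 =>
    rcases h : (b.tidy (j + 2)).coveredChip with _ | γ
    -- Without a covered chip the step is a trivial weakening. This padding lets all inner nodes
    -- carry the same number of structural rules.
    · refine Or.inr ⟨h, Or.inl ?_⟩
      rw [tidy, resetOnce_of_none h]
      exact Weakening.refl _
    · refine Or.inl ⟨γ, h, ?_⟩
      rw [tidy, resetOnce_of_some h]
      exact reset_resetAt (covered_of_coveredChip h)

theorem tidy_control_sublist (j : ℕ) : (b.tidy (j + 1)).control.Sublist (b.tidy j).control := by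
  rcases b.tidy_step j with ⟨γ, -, h⟩ | ⟨-, h | h⟩
  · exact h.2.1
  · exact h.1
  · rw [h.1]

theorem tidy_control_subset (j : ℕ) : (b.tidy j).control ⊆ b.control := by
  induction j with
  | zero => exact fun _ h => h
  | succ j ih => exact fun γ h => ih ((b.tidy_control_sublist j).subset h)

open Classical in
theorem exists_tidy_stack (j : ℕ) {x : X.carrier} {a : A} {S : Set C}
    (hS : S ∈ (b.tidy j).stackSet x a) :
    ∃ S' ∈ (b.tidy (j + 1)).stackSet x a,
      StackStep (b.tidy j).control (b.tidy (j + 1)).control (b.tidyChip j) S S' := by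
  match j with
  | 0 => exact ⟨S, Or.inl hS, StackStep.refl _ _ _ _⟩
  | 1 => exact exists_thin_stack _ hS
  | j + 2 =>
    rcases h : (b.tidy (j + 2)).coveredChip with _ | γ
    · have : b.tidy (j + 2 + 1) = b.tidy (j + 2) := resetOnce_of_none h
      rw [this]
      exact ⟨S, hS, StackStep.refl _ _ _ _⟩
    · have h1 : b.tidy (j + 2 + 1) = (b.tidy (j + 2)).resetAt γ := resetOnce_of_some h
      have h2 : b.tidyChip (j + 2) = some γ := h
      rw [h1, h2]
      exact ⟨_, ⟨S, hS, rfl⟩, stackStep_resetStack _ γ (covered_of_coveredChip h).1 _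
        ((b.tidy (j + 2)).stack_sub x a S hS)⟩

theorem tidy_one_nonempty (x : X.carrier) : ((b.tidy 1).stackSet x ⊥).Nonempty :=
  ⟨∅, Or.inr ⟨rfl, rfl⟩⟩

theorem tidy_subsingleton (j : ℕ) (x : X.carrier) (a : A) :
    ((b.tidy (j + 2)).stackSet x a).Subsingleton := by
  induction j with
  | zero => exact bestStacks_subsingleton _ _
  | succ j ih =>
    rw [show j + 1 + 2 = j + 3 by omega, tidy]
    rcases h : (b.tidy (j + 2)).coveredChip with _ | γ
    · rw [resetOnce_of_none h]
      exact ih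
    · rw [resetOnce_of_some h]
      exact ih.image _

/-- The set of all occurrences of chips on a board with at most one stack at each position. -/
def occurrences (b : Board C X) : Set (X.carrier × A × C) :=
  {p | ∃ S ∈ b.stackSet p.1 p.2.1, p.2.2 ∈ S}

-- A covered chip lies in some stack without being its top, so its reset removes another chip from
-- that stack. As there is only one stack at that position, the occurrence is really lost.
omit [ActivationAlgebra A] in
theorem resetAt_occurrences {b : Board C X} (hb : ∀ x a, (b.stackSet x a).Subsingleton) {γ : C}
    (hγ : b.Covered γ) : (b.resetAt γ).occurrences ⊂ b.occurrences := by
  obtain ⟨x, a, S, hS, hγS⟩ := b.occurs γ hγ.1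
  have htop := hγ.2 x a S hS
  simp only [IsTop, hγS, true_and, not_forall, not_or] at htop
  obtain ⟨δ, hδ, h1, h2⟩ := htop
  refine ⟨?_, fun hsub => ?_⟩
  · rintro ⟨x', a', δ'⟩ ⟨_, ⟨S', hS', rfl⟩, h⟩
    exact ⟨S', hS', h.1⟩
  · obtain ⟨_, ⟨S', hS', rfl⟩, h⟩ := hsub (show (x, a, δ) ∈ b.occurrences from ⟨S, hS, hδ⟩)
    obtain rfl := hb x a hS hS'
    rcases h.2 hγS with h | h
    · exact h1 h
    · exact h2 h

omit [ActivationAlgebra A] in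
theorem isTop_unique {b : Board C X} {γ δ : C} {S : Set C} (h : b.IsTop γ S)
    (h' : b.IsTop δ S) : γ = δ := by
  classical
  by_contra hne
  have h1 := (h.2 δ h'.1).resolve_left (Ne.symm hne)
  have h2 := (h'.2 γ h.1).resolve_left hne
  have := idxOf_lt_of_pair_sublist b.nodup h1
  have := idxOf_lt_of_pair_sublist b.nodup h2
  omega

/-- Each reset destroys an occurrence of a chip, and `K` bounds the number of occurrences before the
first reset. The summand `2` accounts for the population and the weakening. -/
theorem tidy_coveredChip {F : Finset C} (hF : ∀ γ ∈ b.control, γ ∈ F) {K : ℕ}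
    (hK : Nat.card X.carrier * Nat.card A * F.card ≤ K) :
    (b.tidy (K + 2)).coveredChip = none := by
  have : Finite X.carrier := X.finite
  have : Finite A := ActivationAlgebra.finite
  have hfin : ∀ j, (b.tidy j).occurrences ⊆ Set.univ ×ˢ (Set.univ ×ˢ (F : Set C)) := by
    rintro j ⟨x, a, γ⟩ ⟨S, hS, h⟩
    exact ⟨trivial, trivial, hF γ (b.tidy_control_subset j ((b.tidy j).stack_sub x a S hS γ h))⟩
  have hfinite : (Set.univ ×ˢ (Set.univ ×ˢ (F : Set C)) : Set (X.carrier × A × C)).Finite :=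
    Set.finite_univ.prod (Set.finite_univ.prod F.finite_toSet)
  have hcard : (b.tidy 2).occurrences.ncard ≤ K := by
    refine (Set.ncard_le_ncard (hfin 2) hfinite).trans (le_trans (le_of_eq ?_) hK)
    rw [Set.ncard_prod, Set.ncard_prod, Set.ncard_univ, Set.ncard_univ, Set.ncard_coe_finset,
      mul_assoc]
  have key : ∀ j, (b.tidy (j + 2)).coveredChip = none ∨
      (b.tidy (j + 2)).occurrences.ncard + j ≤ (b.tidy 2).occurrences.ncard := by
    intro j
    induction j with
    | zero => exact Or.inr le_rfl
    | succ j ih =>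
      have hsucc : b.tidy (j + 1 + 2) = (b.tidy (j + 2)).resetOnce := rfl
      rcases h : (b.tidy (j + 2)).coveredChip with _ | γ
      · rw [hsucc, resetOnce_of_none h]
        exact Or.inl h
      · right
        rw [hsucc, resetOnce_of_some h]
        have h1 := Set.ncard_lt_ncard (resetAt_occurrences (b.tidy_subsingleton j)
          (covered_of_coveredChip h)) (hfinite.subset (hfin _))
        have h2 := ih.resolve_left (by simp [h])
        omega
  rcases key K with h | h
  · exact h
  -- If all `K` steps were resets, no occurrence is left, so the control is empty.
  · rw [coveredChip_eq_none]
    rintro γ ⟨hγ, -⟩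
    obtain ⟨x, a, S, hS, hγS⟩ := (b.tidy (K + 2)).occurs γ hγ
    have := (Set.ncard_eq_zero (hfinite.subset (hfin _))).1
      (show (b.tidy (K + 2)).occurrences.ncard = 0 by omega)
    exact Set.eq_empty_iff_forall_notMem.1 this (x, a, γ) ⟨S, hS, hγS⟩

/-- When no chip is covered, each chip is the top of the only stack at some position. A stack has
just one top, so the chips inject into the positions. -/
theorem length_control_tidy {F : Finset C} (hF : ∀ γ ∈ b.control, γ ∈ F) {K : ℕ}
    (hK : Nat.card X.carrier * Nat.card A * F.card ≤ K) :
    (b.tidy (K + 2)).control.length ≤ Nat.card X.carrier * Nat.card A := by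
  classical
  have : Finite X.carrier := X.finite
  have : Finite A := ActivationAlgebra.finite
  have h := coveredChip_eq_none.1 (b.tidy_coveredChip hF hK)
  set b' := b.tidy (K + 2)
  have htop : ∀ γ : {γ // γ ∈ b'.control}, ∃ p : X.carrier × A,
      ∃ S ∈ b'.stackSet p.1 p.2, b'.IsTop γ.1 S := by
    rintro ⟨γ, hγ⟩
    have := h γ
    simp only [Covered, hγ, true_and, not_forall, not_not] at this
    obtain ⟨x, a, S, hS, ht⟩ := this
    exact ⟨(x, a), S, hS, ht⟩
  choose f hf using htop
  have hinj : Function.Injective f := by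
    intro γ δ e
    obtain ⟨S, hS, h1⟩ := hf γ
    obtain ⟨S', hS', h2⟩ := hf δ
    rw [← e] at hS'
    obtain rfl := b.tidy_subsingleton K _ _ hS hS'
    exact Subtype.ext (isTop_unique h1 h2)
  have := Nat.card_le_card_of_injective f hinj
  rw [Nat.card_prod, Nat.card_eq_fintype_card, Fintype.card_of_subtype b'.control.toFinset (by simp),
    List.toFinset_card_of_nodup b'.nodup] at this
  exact this

end Tidy

/-! ### Successor boards with fresh chips from a finite supply -/

section Successor

variable [ActivationAlgebra A]

theorem exists_successor (τ : X ⟶ Y) (b : Board C X) (F : Finset C)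
    (hbF : ∀ γ ∈ b.control, γ ∈ F) (hcard : b.control.length + Nat.card Y.carrier ≤ F.card) :
    ∃ b' : Board C Y, Successor τ b b' ∧ ∀ γ ∈ b'.control, γ ∈ F := by
  classical
  have : Finite Y.carrier := Y.finite
  have : Fintype Y.carrier := Fintype.ofFinite _
  -- A chip of `F` outside the control is set aside for every point of `Y`. Only those of the
  -- activated points enter the new control.
  obtain ⟨ι, hι⟩ : ∃ ι : Y.carrier ↪ C, ∀ y, ι y ∈ F \ b.control.toFinset := by
    have h1 : Fintype.card Y.carrier ≤ Fintype.card {γ // γ ∈ F \ b.control.toFinset} := by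
      rw [Fintype.card_coe]
      have h2 := Finset.le_card_sdiff b.control.toFinset F
      have h3 := b.control.toFinset_card_le
      rw [Nat.card_eq_fintype_card] at hcard
      omega
    obtain ⟨g⟩ := Function.Embedding.nonempty_of_card_le h1
    exact ⟨g.trans (Function.Embedding.subtype _), fun y => (g y).2⟩
  let ys : List Y.carrier := (Finset.univ.filter fun y =>
    (moved τ b y ActivationAlgebra.act).Nonempty).toList
  have hys : ∀ y, y ∈ ys ↔ (moved τ b y ActivationAlgebra.act).Nonempty := fun y => by simp [ys]
  have hfresh : ∀ γ ∈ ys.map ι, γ ∉ b.control ∧ γ ∈ F := by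
    intro γ hγ
    obtain ⟨y, -, rfl⟩ := List.mem_map.1 hγ
    have := hι y
    simp only [Finset.mem_sdiff, List.mem_toFinset] at this
    exact ⟨this.2, this.1⟩
  let old : List C := b.control.filter fun γ => decide (∃ y a, ∃ S ∈ moved τ b y a, γ ∈ S)
  have hold : ∀ γ, γ ∈ old ↔ γ ∈ b.control ∧ ∃ y a, ∃ S ∈ moved τ b y a, γ ∈ S := by
    intro γ; simp [old]
  have hmoved : ∀ y a, ∀ S ∈ moved τ b y a, ∀ γ ∈ S, γ ∈ old := by
    intro y a S hS γ hγ
    refine (hold γ).2 ⟨?_, y, a, S, hS, hγ⟩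
    obtain ⟨x, e, c, h, -, -⟩ := hS
    exact b.stack_sub x e S h γ hγ
  refine ⟨{
    control := old ++ ys.map ι
    nodup := ?_
    stackSet := fun y a => if a = ActivationAlgebra.act then ∅ else if a = ⊥ then
      moved τ b y ⊥ ∪ {S' | ∃ S ∈ moved τ b y ActivationAlgebra.act, S' = S ∪ {ι y}}
      else moved τ b y a
    stack_sub := ?_
    occurs := ?_ }, ⟨old, ys.map ι, ι, List.filter_sublist, hold, fun γ hγ => (hfresh γ hγ).1,
      ?_, rfl, ?_, ?_, ?_⟩, ?_⟩
  · refine List.Nodup.append (b.nodup.filter _) ((Finset.nodup_toList _).map ι.injective) ?_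
    intro γ h1 h2
    exact (hfresh γ h2).1 ((hold γ).1 h1).1
  · intro y a S hS γ hγ
    rw [List.mem_append]
    split_ifs at hS with h1 h2
    · exact hS.elim
    · rcases hS with hS | ⟨S, hS, rfl⟩
      · exact Or.inl (hmoved _ _ S hS γ hγ)
      · rcases hγ with hγ | rfl
        · exact Or.inl (hmoved _ _ S hS γ hγ)
        · exact Or.inr (List.mem_map_of_mem ((hys y).2 ⟨S, hS⟩))
    · exact Or.inl (hmoved _ _ S hS γ hγ)
  · intro γ hγ
    rcases List.mem_append.1 hγ with hγ | hγ
    · obtain ⟨-, y, a, S, hS, hγS⟩ := (hold γ).1 hγ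
      by_cases h1 : a = ActivationAlgebra.act
      · subst h1
        refine ⟨y, ⊥, S ∪ {ι y}, ?_, Or.inl hγS⟩
        rw [if_neg ActivationAlgebra.act_ne_bot.symm, if_pos rfl]
        exact Or.inr ⟨S, hS, rfl⟩
      · refine ⟨y, a, S, ?_, hγS⟩
        rw [if_neg h1]
        split_ifs with h2
        · subst h2
          exact Or.inl hS
        · exact hS
    · obtain ⟨y, hy, rfl⟩ := List.mem_map.1 hγ
      obtain ⟨S, hS⟩ := (hys y).1 hy
      refine ⟨y, ⊥, S ∪ {ι y}, ?_, Or.inr rfl⟩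
      rw [if_neg ActivationAlgebra.act_ne_bot.symm, if_pos rfl]
      exact Or.inr ⟨S, hS, rfl⟩
  · refine ⟨fun y hy => List.mem_map_of_mem ((hys y).2 hy), ι.injective.injOn, fun γ hγ => ?_⟩
    obtain ⟨y, hy, rfl⟩ := List.mem_map.1 hγ
    exact ⟨y, (hys y).1 hy, rfl⟩
  · intro y; simp
  · intro y; simp [ActivationAlgebra.act_ne_bot.symm]
  · intro y a h1 h2; simp [h1, h2]
  · intro γ hγ
    rcases List.mem_append.1 hγ with hγ | hγ
    · exact hbF γ ((hold γ).1 hγ).1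
    · exact (hfresh γ hγ).2

variable {τ : X ⟶ Y} {b : Board C X} {b' : Board C Y}

theorem Successor.controlStep (h : Successor τ b b') : ControlStep b.control b'.control := by
  obtain ⟨old, fresh, ι, h1, -, h2, -, h3, -⟩ := h
  exact ⟨old, fresh, h3, h1, h2⟩

theorem Successor.mem_of_ne (h : Successor τ b b') {x : X.carrier} {y : Y.carrier} {e c : A}
    {S : Set C} (hS : S ∈ b.stackSet x e) (hτ : (x, c, y) ∈ TraceHom.rel τ)
    (hne : e ⊔ c ≠ ActivationAlgebra.act) : S ∈ b'.stackSet y (e ⊔ c) := by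
  obtain ⟨old, fresh, ι, -, -, -, -, -, -, h1, h2⟩ := h
  have hm : S ∈ moved τ b y (e ⊔ c) := ⟨x, e, c, hS, hτ, rfl⟩
  by_cases h0 : e ⊔ c = ⊥
  · rw [h0] at hm ⊢
    rw [h1]
    exact Or.inl hm
  · rw [h2 y _ hne h0]
    exact hm

theorem Successor.exists_fresh (h : Successor τ b b') {x : X.carrier} {y : Y.carrier} {e c : A}
    {S : Set C} (hS : S ∈ b.stackSet x e) (hτ : (x, c, y) ∈ TraceHom.rel τ)
    (he : e ⊔ c = ActivationAlgebra.act) :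
    ∃ S' ∈ b'.stackSet y ⊥, S ⊆ S' ∧ ∃ f ∈ S', f ∉ b.control := by
  obtain ⟨old, fresh, ι, -, -, hf, hι, -, -, h1, -⟩ := h
  have hm : S ∈ moved τ b y ActivationAlgebra.act := ⟨x, e, c, hS, hτ, he.symm⟩
  refine ⟨S ∪ {ι y}, ?_, Set.subset_union_left, ι y, Or.inr rfl, hf _ (hι.1 ⟨S, hm⟩)⟩
  rw [h1]
  exact Or.inr ⟨S, hm, rfl⟩

end Successor

/-- A board is determined by its control, a list over `F` without repetitions, and by its sets of
stacks, which are subsets of `F`; finitely many choices remain for both. -/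
theorem finite_setOf_control_subset [Finite A] (F : Finset C) :
    {b : Board C X | ∀ γ ∈ b.control, γ ∈ F}.Finite := by
  classical
  have : Finite X.carrier := X.finite
  have h1 : {l : List C | l.length ≤ F.card ∧ ∀ γ ∈ l, γ ∈ F}.Finite := by
    refine ((List.finite_length_le {γ // γ ∈ F} F.card).image (List.map Subtype.val)).subset ?_
    rintro l ⟨h, hl⟩
    exact ⟨l.attach.map fun γ => ⟨γ.1, hl γ.1 γ.2⟩, by simpa using h, by simp⟩
  have h2 : {σ : X.carrier → A → Set (Set C) |
      ∀ x a, σ x a ∈ {G : Set (Set C) | G ⊆ {S | S ⊆ (F : Set C)}}}.Finite := by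
    have h3 : {G : Set (Set C) | G ⊆ {S | S ⊆ (F : Set C)}}.Finite :=
      F.finite_toSet.finite_subsets.finite_subsets
    exact Set.Finite.pi' fun x => Set.Finite.pi' fun a => h3
  refine Set.Finite.of_injOn (f := fun b : Board C X => (b.control, b.stackSet)) ?_ ?_
    (h1.prod h2)
  · intro b hb
    refine ⟨⟨?_, hb⟩, fun x a S hS γ hγ => hb γ (b.stack_sub x a S hS γ hγ)⟩
    rw [← List.toFinset_card_of_nodup b.nodup]
    exact Finset.card_le_card fun γ hγ => hb γ (by simpa using hγ)
  · rintro ⟨c, _, σ, _, _⟩ - ⟨c', _, σ', _, _⟩ - h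
    simp only [Prod.mk.injEq] at h
    obtain ⟨rfl, rfl⟩ := h
    rfl

end Board

/-! ### Unfolding preproofs -/

namespace Preproof

variable {D : DerivationSystem} (P : Preproof D)

/-- The companion of a bud, and the node itself if it is not a bud. -/
def resolve (s : List ℕ) : List ℕ := (P.back s).getD s

/-- The node of `P` of which the node `w` of the infinite unfolding of `P` is a copy, where the
copies of companions that replace buds are sent to these buds. -/
def unfoldNode (w : List ℕ) : List ℕ := w.foldl (fun s i => P.resolve s ++ [i]) []

variable {P}

theorem resolve_of_some {s c : List ℕ} (h : P.back s = some c) : P.resolve s = c := by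
  simp [resolve, h]

theorem resolve_of_none {s : List ℕ} (h : P.back s = none) : P.resolve s = s := by
  simp [resolve, h]

theorem exists_child_of_prefix {s t : List ℕ} (ht : t ∈ P.tree) (h : s <+: t) (hne : s ≠ t) :
    ∃ i, s ++ [i] ∈ P.tree := by
  obtain ⟨u, rfl⟩ := h
  cases u with
  | nil => simp at hne
  | cons i u => exact ⟨i, P.prefix_closed _ _ ⟨u, by simp⟩ ht⟩

theorem back_eq_none_of_child {s : List ℕ} {i : ℕ} (h : s ++ [i] ∈ P.tree) : P.back s = none := by
  rcases hs : P.back s with _ | c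
  · rfl
  · exact absurd h ((P.bud_leaf s c hs).2 i)

theorem back_eq_none_of_prefix {s t : List ℕ} (ht : t ∈ P.tree) (h : s <+: t) (hne : s ≠ t) :
    P.back s = none :=
  back_eq_none_of_child (exists_child_of_prefix ht h hne).choose_spec

theorem back_companion {s c : List ℕ} (h : P.back s = some c) : P.back c = none :=
  back_eq_none_of_prefix (P.bud_leaf s c h).1 (P.companion_lt s c h).1 (P.companion_lt s c h).2

theorem back_resolve (s : List ℕ) : P.back (P.resolve s) = none := by
  rcases h : P.back s with _ | c
  · rw [resolve_of_none h, h]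
  · rw [resolve_of_some h, back_companion h]

theorem label_resolve (s : List ℕ) : P.label (P.resolve s) = P.label s := by
  rcases h : P.back s with _ | c
  · rw [resolve_of_none h]
  · rw [resolve_of_some h, P.label_back s c h]

theorem resolve_mem {s : List ℕ} (hs : s ∈ P.tree) : P.resolve s ∈ P.tree := by
  rcases h : P.back s with _ | c
  · rwa [resolve_of_none h]
  · rw [resolve_of_some h]
    exact P.prefix_closed _ _ (P.companion_lt s c h).1 hs

theorem mem_of_resolve_mem {s : List ℕ} (hs : P.resolve s ∈ P.tree) : s ∈ P.tree := by
  rcases h : P.back s with _ | c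
  · rwa [resolve_of_none h] at hs
  · exact (P.bud_leaf s c h).1

@[simp]
theorem unfoldNode_nil : P.unfoldNode [] = [] := rfl

@[simp]
theorem unfoldNode_concat (w : List ℕ) (i : ℕ) :
    P.unfoldNode (w ++ [i]) = P.resolve (P.unfoldNode w) ++ [i] := by
  simp [unfoldNode]

theorem unfoldNode_mem_of_concat {w : List ℕ} {i : ℕ} (h : P.unfoldNode (w ++ [i]) ∈ P.tree) :
    P.unfoldNode w ∈ P.tree := by
  rw [unfoldNode_concat] at h
  exact mem_of_resolve_mem (P.prefix_closed _ _ (List.prefix_append _ _) h)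

theorem unfoldNode_of_mem {w : List ℕ} (h : w ∈ P.tree) : P.unfoldNode w = w := by
  induction w using List.reverseRecOn with
  | nil => rfl
  | append_singleton w i ih =>
    rw [unfoldNode_concat, ih (P.prefix_closed _ _ (List.prefix_append _ _) h),
      resolve_of_none (back_eq_none_of_child h)]

/-- The part of the infinite unfolding strictly below a node depends only on the resolved node. The
case `u = []` is excluded because `unfoldNode` does not resolve the node at which it ends. -/
theorem unfoldNode_append_congr {t c : List ℕ}
    (h : P.resolve (P.unfoldNode t) = P.resolve (P.unfoldNode c)) {u : List ℕ} (hu : u ≠ []) :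
    P.unfoldNode (t ++ u) = P.unfoldNode (c ++ u) := by
  cases u with
  | nil => exact absurd rfl hu
  | cons i u =>
    simp only [unfoldNode, List.foldl_append, List.foldl_cons] at h ⊢
    rw [h]

variable (P)

/-- The proper prefix `d` of `w` can serve as a companion of `w` in an unfolding. -/
def IsCandidate (w d : List ℕ) : Prop :=
  d <+: w ∧ d ≠ w ∧ P.resolve (P.unfoldNode d) = P.resolve (P.unfoldNode w)

/-- The nodes of `P₁` are copies of nodes of `P`, as given by the infinite unfolding of `P`. -/
structure IsPartialUnfolding (P₁ : Preproof D) (p₁ : List ℕ → List ℕ) : Prop where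
  mem : ∀ w ∈ P₁.tree, P.unfoldNode w ∈ P.tree
  label : ∀ w ∈ P₁.tree, P₁.label w = P.label (P.unfoldNode w)
  proj_inner : ∀ w ∈ P₁.tree, P₁.back w = none → p₁ w = P.resolve (P.unfoldNode w)
  rule_inner : ∀ w ∈ P₁.tree, P₁.back w = none → P₁.rule w = P.rule (P.resolve (P.unfoldNode w))
  proj_bud : ∀ w d, P₁.back w = some d → p₁ w = P.unfoldNode w
  back_bud : ∀ w d, P₁.back w = some d → P.back (P.unfoldNode w) = some (p₁ d)

theorem isPartialUnfolding_self : P.IsPartialUnfolding P id where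
  mem w hw := by rwa [unfoldNode_of_mem hw]
  label w hw := by rw [unfoldNode_of_mem hw]
  proj_inner w hw h := by rw [unfoldNode_of_mem hw, resolve_of_none h]; rfl
  rule_inner w hw h := by rw [unfoldNode_of_mem hw, resolve_of_none h]
  proj_bud w d h := by rw [unfoldNode_of_mem (P.bud_leaf w d h).1]; rfl
  back_bud w d h := by rw [unfoldNode_of_mem (P.bud_leaf w d h).1, h]; rfl

open Classical in
/-- The node of which `s` is a copy after an unfolding at the bud `t` with companion `c`. -/
noncomputable def copySource (t c s : List ℕ) : List ℕ :=
  if t <+: s then c ++ s.drop t.length else s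

theorem copySource_append (t c u : List ℕ) : copySource t c (t ++ u) = c ++ u := by
  simp [copySource]

theorem copySource_self (t c : List ℕ) : copySource t c t = c := by
  simpa using copySource_append t c []

theorem copySource_of_not_prefix {t c s : List ℕ} (h : ¬ t <+: s) : copySource t c s = s := by
  simp [copySource, h]

theorem copySource_concat {t c s : List ℕ} {i : ℕ} (h : s ++ [i] ≠ t) :
    copySource t c (s ++ [i]) = copySource t c s ++ [i] := by
  by_cases ht : t <+: s
  · obtain ⟨u, rfl⟩ := ht
    rw [List.append_assoc, copySource_append, copySource_append, List.append_assoc]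
  · rw [copySource_of_not_prefix ht, copySource_of_not_prefix]
    intro h'
    rcases List.prefix_concat_iff.1 h' with h' | h'
    · exact h h'.symm
    · exact ht h'

/-! ### Unfolding at one bud -/

section UnfoldAt

variable {P₁ : Preproof D} {t c : List ℕ} (htc : P₁.back t = some c)

include htc

theorem not_prefix_companion : ¬ t <+: c := fun h =>
  (P₁.companion_lt t c htc).2
    ((P₁.companion_lt t c htc).1.eq_of_length_le h.length_le)

theorem eq_of_bud_prefix {s : List ℕ} (hs : s ∈ P₁.tree) (h : t <+: s) : s = t := by
  by_contra hne
  obtain ⟨i, hi⟩ := exists_child_of_prefix hs h (Ne.symm hne)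
  exact (P₁.bud_leaf t c htc).2 i hi

omit htc in
theorem copySource_prefix_bud {s : List ℕ} (h : s <+: t) (hne : s ≠ t) : copySource t c s = s :=
  copySource_of_not_prefix fun h' => hne (h.eq_of_length_le h'.length_le)

theorem companion_mem : c ∈ P₁.tree :=
  P₁.prefix_closed _ _ (P₁.companion_lt t c htc).1 (P₁.bud_leaf t c htc).1

/-- The source commutes with passing to a child except at `s ++ [i] = t`, where it jumps to `c`.
There both sides hold, as `c` and `t` are nodes of the tree. -/
theorem copySource_concat_mem {s : List ℕ} {i : ℕ} :
    copySource t c (s ++ [i]) ∈ P₁.tree ↔ copySource t c s ++ [i] ∈ P₁.tree := by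
  by_cases h : s ++ [i] = t
  · have hs : copySource t c s = s := copySource_prefix_bud (h ▸ List.prefix_append _ _)
      (by rw [← h]; simp)
    rw [hs, h, copySource_self]
    exact iff_of_true (companion_mem htc) (P₁.bud_leaf t c htc).1
  · rw [copySource_concat h]

theorem label_copySource_concat {s : List ℕ} {i : ℕ} :
    P₁.label (copySource t c (s ++ [i])) = P₁.label (copySource t c s ++ [i]) := by
  by_cases h : s ++ [i] = t
  · have hs : copySource t c s = s := copySource_prefix_bud (h ▸ List.prefix_append _ _)
      (by rw [← h]; simp)
    rw [hs, h, copySource_self, P₁.label_back t c htc]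
  · rw [copySource_concat h]

theorem copySource_mem_of_prefix {s s' : List ℕ} (h : s <+: s')
    (h' : copySource t c s' ∈ P₁.tree) : copySource t c s ∈ P₁.tree := by
  obtain ⟨u, rfl⟩ := h
  induction u using List.reverseRecOn with
  | nil => simpa using h'
  | append_singleton u i ih =>
    rw [← List.append_assoc, copySource_concat_mem htc] at h'
    exact ih (P₁.prefix_closed _ _ (List.prefix_append _ _) h')

open Classical in
/-- The unfolding of `P₁` at the bud `t` with companion `c`, where the companions of the copied
buds are given by `comp`. -/
noncomputable def unfoldAt (comp : List ℕ → List ℕ)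
    (hcomp : ∀ s, t <+: s → P₁.back (copySource t c s) ≠ none → comp s <+: s ∧ comp s ≠ s ∧
      P₁.label (copySource t c (comp s)) = P₁.label (copySource t c s)) : Preproof D where
  tree := {s | copySource t c s ∈ P₁.tree}
  finite := by
    refine (P₁.finite.union (P₁.finite.image fun v => t ++ v.drop c.length)).subset ?_
    intro s hs
    by_cases h : t <+: s
    · obtain ⟨u, rfl⟩ := h
      exact Or.inr ⟨c ++ u, by simpa [copySource_append] using hs, by simp⟩
    · exact Or.inl (by simpa [copySource_of_not_prefix h] using hs)
  root_mem := by
    have h : t ≠ [] := by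
      rintro rfl
      exact not_prefix_companion htc (List.nil_prefix)
    show copySource t c [] ∈ P₁.tree
    rw [copySource_prefix_bud List.nil_prefix (Ne.symm h)]
    exact P₁.root_mem
  prefix_closed s s' h h' := copySource_mem_of_prefix htc h h'
  back s := if t <+: s then (P₁.back (copySource t c s)).map fun _ => comp s else P₁.back s
  bud_leaf s d h := by
    obtain ⟨d', hd'⟩ : ∃ d', P₁.back (copySource t c s) = some d' := by
      split_ifs at h with hs
      · exact (Option.map_eq_some_iff.1 h).imp fun _ h => h.1
      · exact ⟨d, by rwa [copySource_of_not_prefix hs]⟩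
    refine ⟨(P₁.bud_leaf _ _ hd').1, fun i hi => (P₁.bud_leaf _ _ hd').2 i ?_⟩
    exact (copySource_concat_mem htc).1 hi
  companion_lt s d h := by
    split_ifs at h with hs
    · obtain ⟨d', hd', rfl⟩ := Option.map_eq_some_iff.1 h
      exact ⟨(hcomp s hs (by simp [hd'])).1, (hcomp s hs (by simp [hd'])).2.1⟩
    · exact P₁.companion_lt s d h
  label s := P₁.label (copySource t c s)
  rule s := P₁.rule (copySource t c s)
  label_back s d h := by
    split_ifs at h with hs
    · obtain ⟨d', hd', rfl⟩ := Option.map_eq_some_iff.1 h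
      exact (hcomp s hs (by simp [hd'])).2.2.symm
    · rw [copySource_of_not_prefix hs, copySource_of_not_prefix, P₁.label_back s d h]
      exact fun h' => hs (h'.trans (P₁.companion_lt s d h).1)
  rule_dom s r h := by
    obtain ⟨h1, h2⟩ := P₁.rule_dom _ _ h
    refine ⟨h1, ?_⟩
    split_ifs with hs
    · simp [h2]
    · rwa [copySource_of_not_prefix hs] at h2
  rule_concl s r h := P₁.rule_concl _ _ h
  rule_children s r h i := (copySource_concat_mem htc).trans (P₁.rule_children _ _ h i)
  rule_prem s r h i := (label_copySource_concat htc).trans (P₁.rule_prem _ _ h i)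
  leaf_of_no_rule s hs h i hi :=
    P₁.leaf_of_no_rule _ hs h i ((copySource_concat_mem htc).1 hi)

end UnfoldAt

variable {P} {P₁ : Preproof D} {p₁ : List ℕ → List ℕ}

/-- A bud of `P₁` and its companion resolve to the same node of `P`, so the infinite unfolding looks
alike below them. At `t` itself only the resolved nodes need to agree. -/
theorem IsPartialUnfolding.resolve_copySource (h : P.IsPartialUnfolding P₁ p₁) {t c : List ℕ}
    (htc : P₁.back t = some c) (s : List ℕ) :
    P.resolve (P.unfoldNode s) = P.resolve (P.unfoldNode (copySource t c s)) ∧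
      (s ≠ t → P.unfoldNode s = P.unfoldNode (copySource t c s)) := by
  have hr : P.resolve (P.unfoldNode t) = P.resolve (P.unfoldNode c) := by
    rw [resolve_of_some (h.back_bud t c htc),
      h.proj_inner c (companion_mem htc) (back_companion htc)]
  by_cases ht : t <+: s
  · obtain ⟨u, rfl⟩ := ht
    rw [copySource_append]
    by_cases hu : u = []
    · subst hu
      simpa using hr
    · have := unfoldNode_append_congr hr hu
      exact ⟨by rw [this], fun _ => this⟩
  · rw [copySource_of_not_prefix ht]
    exact ⟨rfl, fun _ => rfl⟩

/-- Let `c ++ u` be the copied bud and `d` its companion in `P₁`. If `d` lies in the copied subtree,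
its copy below `t` serves. Otherwise `d` is a prefix of `c`, hence also of `t`, and serves itself.
-/
theorem IsPartialUnfolding.exists_candidate (h : P.IsPartialUnfolding P₁ p₁) {t c : List ℕ}
    (htc : P₁.back t = some c) {s : List ℕ} (hs : t <+: s)
    (hb : P₁.back (copySource t c s) ≠ none) : ∃ d, P.IsCandidate s d := by
  obtain ⟨u, rfl⟩ := hs
  obtain ⟨d, hd⟩ := Option.ne_none_iff_exists'.1 hb
  have hr := (h.resolve_copySource htc (t ++ u)).1
  rw [resolve_of_some (h.back_bud _ _ hd), h.proj_inner d (companion_mem hd) (back_companion hd)]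
    at hr
  rw [copySource_append] at hd
  obtain ⟨h1, h2⟩ := P₁.companion_lt _ _ hd
  by_cases hc : c <+: d
  · obtain ⟨v, rfl⟩ := hc
    refine ⟨t ++ v, (List.prefix_append_right_inj t).2 ((List.prefix_append_right_inj c).1 h1),
      fun e => h2 (by rw [List.append_cancel_left e]), ?_⟩
    rw [hr, (h.resolve_copySource htc (t ++ v)).1, copySource_append]
  · have hdc : d <+: c :=
      (List.prefix_or_prefix_of_prefix h1 (List.prefix_append c u)).resolve_right hc
    have hdt : d <+: t := hdc.trans (P₁.companion_lt t c htc).1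
    refine ⟨d, hdt.trans (List.prefix_append _ _), fun e => ?_, hr.symm⟩
    exact not_prefix_companion htc ((List.prefix_append t u).trans (e ▸ hdc))

theorem IsPartialUnfolding.exists_step (h : P.IsPartialUnfolding P₁ p₁) {t c : List ℕ}
    (htc : P₁.back t = some c) (comp : List ℕ → List ℕ)
    (hcomp : ∀ s, (∃ d, P.IsCandidate s d) → P.IsCandidate s (comp s)) :
    ∃ (P₂ : Preproof D) (p₂ : List ℕ → List ℕ), UnfoldStep P P₁ p₁ t c P₂ p₂ ∧
      P.IsPartialUnfolding P₂ p₂ ∧ ∀ s d, P₂.back s = some d → P₁.back s = some d ∨ d = comp s := by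
  -- A proper prefix of `s` has a child in the new tree, so its source is not a bud. It is therefore
  -- a copy of the resolved node, as the companion of a copied bud has to be.
  have hcand : ∀ s, t <+: s → P₁.back (copySource t c s) ≠ none →
      P.IsCandidate s (comp s) ∧ P₁.back (copySource t c (comp s)) = none ∧
        copySource t c (comp s) ∈ P₁.tree := by
    intro s hs hb
    have hc := hcomp s (h.exists_candidate htc hs hb)
    obtain ⟨d, hd⟩ := Option.ne_none_iff_exists'.1 hb
    refine ⟨hc, ?_⟩
    obtain ⟨⟨u, hu⟩, h2, -⟩ := hc
    cases u with
    | nil => simp at hu; exact absurd hu h2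
    | cons i u =>
      have h3 : copySource t c (comp s ++ [i]) ∈ P₁.tree := by
        refine copySource_mem_of_prefix htc (s' := s) ⟨u, by simpa using hu⟩ ?_
        exact (P₁.bud_leaf _ _ hd).1
      rw [copySource_concat_mem htc] at h3
      exact ⟨back_eq_none_of_child h3, P₁.prefix_closed _ _ (List.prefix_append _ _) h3⟩
  have hlabel : ∀ s, t <+: s → P₁.back (copySource t c s) ≠ none → comp s <+: s ∧ comp s ≠ s ∧
      P₁.label (copySource t c (comp s)) = P₁.label (copySource t c s) := by
    intro s hs hb
    obtain ⟨hc, -, h2⟩ := hcand s hs hb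
    refine ⟨hc.1, hc.2.1, ?_⟩
    obtain ⟨d, hd⟩ := Option.ne_none_iff_exists'.1 hb
    rw [h.label _ h2, h.label _ (P₁.bud_leaf _ _ hd).1, ← label_resolve,
      ← (h.resolve_copySource htc _).1, hc.2.2, (h.resolve_copySource htc _).1, label_resolve]
  have hbc : P₁.back c = none := back_companion htc
  have hnot : ∀ s ∈ P₁.tree, s ≠ t → ¬ t <+: s := fun s hs hne ht =>
    hne (eq_of_bud_prefix htc hs ht)
  have hbacknone : ∀ s, (unfoldAt htc comp hlabel).back s = none ↔
      P₁.back (copySource t c s) = none := by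
    intro s
    simp only [unfoldAt]
    split_ifs with hs
    · simp
    · rw [copySource_of_not_prefix hs]
  have hbacksome : ∀ s d, (unfoldAt htc comp hlabel).back s = some d →
      (t <+: s ∧ d = comp s ∧ P₁.back (copySource t c s) ≠ none) ∨
        (¬ t <+: s ∧ P₁.back s = some d) := by
    intro s d hd
    simp only [unfoldAt] at hd
    split_ifs at hd with hs
    · obtain ⟨d', hd', rfl⟩ := Option.map_eq_some_iff.1 hd
      exact Or.inl ⟨hs, rfl, by simp [hd']⟩
    · exact Or.inr ⟨hs, hd⟩
  have hback : ∀ s d, (unfoldAt htc comp hlabel).back s = some d →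
      s ≠ t ∧ p₁ (copySource t c s) = P.unfoldNode s ∧
        P.back (P.unfoldNode s) = some (p₁ (copySource t c d)) := by
    intro s d hd
    have hst : s ≠ t := by
      rintro rfl
      have := (hbacknone s).2 (by rw [copySource_self]; exact hbc)
      rw [this] at hd
      cases hd
    refine ⟨hst, ?_⟩
    rw [(h.resolve_copySource htc s).2 hst]
    rcases hbacksome s d hd with ⟨hs, rfl, hb⟩ | ⟨hs, hb⟩
    · obtain ⟨d', hd'⟩ := Option.ne_none_iff_exists'.1 hb
      refine ⟨h.proj_bud _ _ hd', ?_⟩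
      obtain ⟨hc, h1, h2⟩ := hcand s hs hb
      rw [h.proj_inner _ h2 h1, ← (h.resolve_copySource htc _).1, hc.2.2,
        (h.resolve_copySource htc _).1, resolve_of_some (h.back_bud _ _ hd'), h.back_bud _ _ hd']
    · have hd' : ¬ t <+: d := fun h' => hs (h'.trans (P₁.companion_lt s d hb).1)
      rw [copySource_of_not_prefix hs, copySource_of_not_prefix hd']
      exact ⟨h.proj_bud _ _ hb, h.back_bud _ _ hb⟩
  refine ⟨unfoldAt htc comp hlabel, fun s => p₁ (copySource t c s), ?_, ?_, ?_⟩
  · refine ⟨htc, ?_, ?_, ?_, ?_, ?_, ?_, ?_, ?_, ?_, ?_⟩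
    · ext s
      simp only [unfoldAt, Set.mem_union, Set.mem_ofPred_eq]
      by_cases hs : t <+: s
      · obtain ⟨u, rfl⟩ := hs
        rw [copySource_append]
        refine ⟨fun h => Or.inr ⟨u, rfl, h⟩, ?_⟩
        rintro (h | ⟨v, hv, h⟩)
        · have := eq_of_bud_prefix htc h (List.prefix_append _ _)
          have hu : u = [] := by simpa using this
          rw [hu, List.append_nil]
          exact companion_mem htc
        · rwa [List.append_cancel_left hv]
      · rw [copySource_of_not_prefix hs]
        refine ⟨Or.inl, ?_⟩
        rintro (h | ⟨v, rfl, h⟩)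
        · exact h
        · exact absurd (List.prefix_append _ _) hs
    · intro s hs hne
      simp [unfoldAt, copySource_of_not_prefix (hnot s hs hne)]
    · intro s hs hne
      simp [unfoldAt, copySource_of_not_prefix (hnot s hs hne)]
    · intro s hs hne
      simp [unfoldAt, hnot s hs hne]
    · intro s hs hne
      simp [copySource_of_not_prefix (hnot s hs hne)]
    · intro u hu
      simp [unfoldAt, copySource_append]
    · intro u hu
      simp [unfoldAt, copySource_append]
    · intro u hu
      simp [copySource_append]
    · intro u hu
      rw [hbacknone, copySource_append]
    · intro u d hu hd
      obtain ⟨-, h1, h2⟩ := hback _ _ hd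
      rw [h1, h2]
  · refine ⟨?_, ?_, ?_, ?_, fun w d hd => (hback w d hd).2.1, fun w d hd => (hback w d hd).2.2⟩
    · intro w hw
      by_cases hwt : w = t
      · rw [hwt]
        exact h.mem t (P₁.bud_leaf t c htc).1
      · rw [(h.resolve_copySource htc w).2 hwt]
        exact h.mem _ hw
    · intro w hw
      show P₁.label (copySource t c w) = _
      rw [h.label _ hw, ← label_resolve, ← (h.resolve_copySource htc w).1, label_resolve]
    · intro w hw hb
      rw [(h.resolve_copySource htc w).1]
      exact h.proj_inner _ hw ((hbacknone w).1 hb)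
    · intro w hw hb
      rw [(h.resolve_copySource htc w).1]
      exact h.rule_inner _ hw ((hbacknone w).1 hb)
  · intro s d hd
    rcases hbacksome s d hd with ⟨-, h1, -⟩ | ⟨-, h1⟩
    · exact Or.inr h1
    · exact Or.inl h1

end Preproof

/-! ### Kőnig's lemma and the termination of unfolding -/

/-- A version of Kőnig's lemma. -/
theorem exists_branch_of_infinite {U : Set (List ℕ)} (hU : U.Infinite)
    (hprefix : ∀ s t, s <+: t → t ∈ U → s ∈ U) (hfin : ∀ s, {i | s ++ [i] ∈ U}.Finite) :
    ∃ β : ℕ → List ℕ, β 0 = [] ∧ (∀ n, ∃ i, β (n + 1) = β n ++ [i]) ∧ ∀ n, β n ∈ U := by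
  -- The branch runs through the nodes with infinitely many extensions in `U`. By finite branching
  -- each of them has a child of the same kind.
  let big : Set (List ℕ) := {s | {x ∈ U | s <+: x}.Infinite}
  have hroot : [] ∈ big := by simpa [big] using hU
  have hstep : ∀ s : big, ∃ i, s.1 ++ [i] ∈ big := by
    rintro ⟨s, hs⟩
    by_contra hcon
    push Not at hcon
    refine hs (((Set.finite_singleton s).union ((hfin s).biUnion
      (t := fun i => {x ∈ U | s ++ [i] <+: x}) fun i _ => ?_)).subset ?_)
    · exact Set.not_infinite.1 (hcon i)
    · rintro x ⟨hx, u, rfl⟩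
      cases u with
      | nil => simp
      | cons i u =>
        have h : s ++ [i] <+: s ++ i :: u := ⟨u, by simp⟩
        exact Or.inr (Set.mem_biUnion (hprefix _ _ h hx) ⟨hx, h⟩)
  choose f hf using hstep
  let β : ℕ → big := fun n => Nat.rec ⟨[], hroot⟩ (fun _ s => ⟨s.1 ++ [f s], hf s⟩) n
  refine ⟨fun n => (β n).1, rfl, fun n => ⟨f (β n), rfl⟩, fun n => ?_⟩
  obtain ⟨x, hx, h⟩ := (β n).2.nonempty
  exact hprefix _ _ h hx

theorem branch_length {β : ℕ → List ℕ} (h0 : β 0 = []) (hβ : ∀ n, ∃ i, β (n + 1) = β n ++ [i])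
    (n : ℕ) : (β n).length = n := by
  induction n with
  | zero => simp [h0]
  | succ n ih =>
    obtain ⟨i, hi⟩ := hβ n
    simp [hi, ih]

theorem branch_prefix {β : ℕ → List ℕ} (hβ : ∀ n, ∃ i, β (n + 1) = β n ++ [i]) {m n : ℕ}
    (h : m ≤ n) : β m <+: β n := by
  induction n, h using Nat.le_induction with
  | base => exact List.prefix_rfl
  | succ n _ ih =>
    obtain ⟨i, hi⟩ := hβ n
    exact ih.trans (hi ▸ List.prefix_append _ _)

theorem eq_branch_of_prefix {β : ℕ → List ℕ} (h0 : β 0 = [])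
    (hβ : ∀ n, ∃ i, β (n + 1) = β n ++ [i]) {n : ℕ} {s : List ℕ} (h : s <+: β n) :
    s = β s.length := by
  have hle : s.length ≤ n := by simpa [branch_length h0 hβ] using h.length_le
  refine (List.prefix_of_prefix_length_le h (branch_prefix hβ hle) ?_).eq_of_length_le ?_ <;>
  simp [branch_length h0 hβ]

/-- In a strictly increasing sequence of trees, each of which arises from its predecessor by
extending it at a leaf, some branch is extended infinitely often. -/
theorem exists_branch_of_extensions {T : ℕ → Set (List ℕ)} {t : ℕ → List ℕ}
    (hT : ∀ n, (T n).Finite) (hprefix : ∀ n s s', s <+: s' → s' ∈ T n → s ∈ T n)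
    (hmono : ∀ n, T n ⊂ T (n + 1)) (ht : ∀ n, t n ∈ T n) (hleaf : ∀ n i, t n ++ [i] ∉ T n)
    (hnew : ∀ n, ∀ s ∈ T (n + 1), s ∉ T n → t n <+: s)
    (hfin : ∀ s, {i | ∃ n, s ++ [i] ∈ T n}.Finite) :
    ∃ β : ℕ → List ℕ, β 0 = [] ∧ (∀ n, ∃ i, β (n + 1) = β n ++ [i]) ∧ (∀ n, ∃ k, β n ∈ T k) ∧
      ∀ N, ∃ n ≥ N, ∃ k, t k = β n := by
  -- A finite union would have only finitely many subsets, whereas the trees `T n` are pairwise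
  -- distinct.
  have hstrict : StrictMono T := strictMono_nat_of_lt_succ hmono
  have hinf : (⋃ n, T n).Infinite := by
    intro hfinU
    have : (Set.range T).Finite :=
      hfinU.finite_subsets.subset (by rintro _ ⟨n, rfl⟩; exact Set.subset_iUnion T n)
    exact Set.infinite_range_of_injective hstrict.injective this
  obtain ⟨β, h0, hβ, hmem⟩ := exists_branch_of_infinite hinf
    (by
      intro s s' h hs'
      obtain ⟨n, hn⟩ := Set.mem_iUnion.1 hs'
      exact Set.mem_iUnion.2 ⟨n, hprefix n _ _ h hn⟩)
    (by simpa using hfin)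
  have hmem' : ∀ n, ∃ k, β n ∈ T k := fun n => Set.mem_iUnion.1 (hmem n)
  refine ⟨β, h0, hβ, hmem', fun N => ?_⟩
  classical
  obtain ⟨n, hn⟩ := hmem' N
  -- Let `β M` be the last node of the branch in `T n`, and let `β (M + 1)` first appear at stage `n
  -- + j + 1`. The leaf extended at stage `n + j` is then a prefix of `β M`, and being a leaf it
  -- equals `β M`.
  have hex : ∃ M, β M ∉ T n := by
    by_contra hcon
    push Not at hcon
    refine Set.infinite_range_of_injective (f := β) ?_ ((hT n).subset ?_)
    · intro a b e
      rw [← branch_length h0 hβ a, e, branch_length h0 hβ]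
    · rintro _ ⟨M, rfl⟩
      exact hcon M
  have hM := Nat.find_spec hex
  have hlt : N < Nat.find hex := by
    by_contra hle
    exact hM (hprefix n _ _ (branch_prefix hβ (not_lt.1 hle)) hn)
  obtain ⟨M, hM'⟩ : ∃ M, Nat.find hex = M + 1 := ⟨Nat.find hex - 1, by omega⟩
  have hMn : β M ∈ T n := by
    by_contra h
    have := Nat.find_min' hex h
    omega
  rw [hM'] at hM hlt
  have hex2 : ∃ k, β (M + 1) ∈ T (n + k) := by
    obtain ⟨k, hk⟩ := hmem' (M + 1)
    exact ⟨k, hstrict.monotone (by omega) hk⟩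
  obtain ⟨j, hj⟩ : ∃ j, Nat.find hex2 = j + 1 := by
    refine ⟨Nat.find hex2 - 1, ?_⟩
    rcases h : Nat.find hex2 with _ | j
    · exact absurd (by simpa [h] using Nat.find_spec hex2) hM
    · simp
  have h1 : β (M + 1) ∈ T (n + j + 1) := by
    have := Nat.find_spec hex2
    rwa [hj] at this
  have h2 : β (M + 1) ∉ T (n + j) := fun h => by
    have := Nat.find_min' hex2 h
    omega
  refine ⟨M, by omega, n + j, ?_⟩
  obtain ⟨i, hi⟩ := hβ M
  have h3 := hnew _ _ h1 h2
  rw [hi] at h3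
  rcases List.prefix_concat_iff.1 h3 with h3 | h3
  · exact absurd (h3 ▸ ht (n + j)) (hi ▸ h2)
  · by_contra hne
    obtain ⟨u, hu⟩ := h3
    cases u with
    | nil => exact hne (by simpa using hu)
    | cons i u =>
      refine hleaf (n + j) i (hprefix _ _ _ ⟨u, ?_⟩ (hstrict.monotone (Nat.le_add_right n j) hMn))
      rw [← hu]; simp

/-- If on every branch of the infinite unfolding all but finitely many copies of buds have a
good companion, then there is an unfolding all of whose buds have good companions. -/
theorem exists_good_unfolding {D : DerivationSystem} (P : Preproof D)
    (Good : List ℕ → List ℕ → Prop) (hGood : ∀ w d, Good w d → P.IsCandidate w d)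
    (H : ∀ β : ℕ → List ℕ, β 0 = [] → (∀ n, ∃ i, β (n + 1) = β n ++ [i]) →
      (∀ n, P.unfoldNode (β n) ∈ P.tree) →
      ∃ N, ∀ n ≥ N, P.back (P.unfoldNode (β n)) ≠ none → ∃ d, Good (β n) d) :
    ∃ Q p, UnfoldsTo P Q p ∧ P.IsPartialUnfolding Q p ∧ ∀ w d, Q.back w = some d → Good w d := by
  classical
  by_contra hcon
  -- Assuming that bad buds never run out, one of them is unfolded again and again. `comp` picks a
  -- good companion if there is one, and any candidate otherwise; the value `[]` is only a default.
  let comp : List ℕ → List ℕ := fun s => if h : ∃ d, Good s d then h.choose else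
    if h : ∃ d, P.IsCandidate s d then h.choose else []
  have hcomp : ∀ s, (∃ d, P.IsCandidate s d) → P.IsCandidate s (comp s) := by
    intro s hs
    simp only [comp]
    split_ifs with h
    · exact hGood _ _ h.choose_spec
    · exact hs.choose_spec
  have hcomp' : ∀ s, (∃ d, Good s d) → Good s (comp s) := by
    intro s hs
    simp only [comp, dif_pos hs]
    exact hs.choose_spec
  -- The last clause records that a companion not picked by `comp` can only belong to a bud at an
  -- address of the original tree.
  let Stage := {x : Preproof D × (List ℕ → List ℕ) // UnfoldsTo P x.1 x.2 ∧
    P.IsPartialUnfolding x.1 x.2 ∧ ∀ w d, x.1.back w = some d → w ∈ P.tree ∨ d = comp w}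
  have hnext : ∀ x : Stage, ∃ (y : Stage) (t : List ℕ) (c : List ℕ), ¬ Good t c ∧
      UnfoldStep P x.1.1 x.1.2 t c y.1.1 y.1.2 := by
    rintro ⟨⟨P₁, p₁⟩, h1, h2, h3⟩
    have : ∃ t c, P₁.back t = some c ∧ ¬ Good t c := by
      by_contra h
      push Not at h
      exact hcon ⟨P₁, p₁, h1, h2, h⟩
    obtain ⟨t, c, htc, hbad⟩ := this
    obtain ⟨P₂, p₂, h4, h5, h6⟩ := h2.exists_step htc comp hcomp
    refine ⟨⟨⟨P₂, p₂⟩, UnfoldsTo.step h1 h4, h5, fun w d hd => ?_⟩, t, c, hbad, h4⟩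
    rcases h6 w d hd with h | h
    · exact h3 w d h
    · exact Or.inr h
  choose next t c hbad hstep using hnext
  let x : ℕ → Stage := fun n => Nat.rec
    ⟨⟨P, id⟩, UnfoldsTo.refl, P.isPartialUnfolding_self, fun w d h => Or.inl (P.bud_leaf w d h).1⟩
    (fun _ y => next y) n
  have hx : ∀ n, UnfoldStep P (x n).1.1 (x n).1.2 (t (x n)) (c (x n)) (x (n + 1)).1.1
      (x (n + 1)).1.2 := fun n => hstep (x n)
  have hmemP : ∀ n, ∀ w ∈ (x n).1.1.tree, P.unfoldNode w ∈ P.tree := fun n => (x n).2.2.1.mem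
  obtain ⟨β, h0, hβ, hmem, hinf⟩ := exists_branch_of_extensions (T := fun n => (x n).1.1.tree)
    (t := fun n => t (x n)) (fun n => (x n).1.1.finite)
    (fun n => (x n).1.1.prefix_closed)
    (by
      intro n
      obtain ⟨i, hi⟩ := Preproof.exists_child_of_prefix ((x n).1.1.bud_leaf _ _ (hx n).bud).1
        ((x n).1.1.companion_lt _ _ (hx n).bud).1 ((x n).1.1.companion_lt _ _ (hx n).bud).2
      refine Set.ssubset_iff_of_subset ?_ |>.2 ⟨t (x n) ++ [i], ?_,
        ((x n).1.1.bud_leaf _ _ (hx n).bud).2 i⟩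
      · rw [(hx n).tree]; exact Set.subset_union_left
      · rw [(hx n).tree]; exact Or.inr ⟨[i], rfl, hi⟩)
    (fun n => ((x n).1.1.bud_leaf _ _ (hx n).bud).1)
    (fun n => ((x n).1.1.bud_leaf _ _ (hx n).bud).2)
    (by
      intro n s hs hs'
      rw [(hx n).tree] at hs
      rcases hs with hs | ⟨u, rfl, -⟩
      · exact absurd hs hs'
      · exact List.prefix_append _ _)
    (by
      intro s
      refine Set.Finite.subset (P.finite.preimage (f := fun i => P.resolve (P.unfoldNode s) ++ [i])
        fun a _ b _ h => by simpa using h) ?_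
      rintro i ⟨n, hn⟩
      simpa using hmemP n _ hn)
  have hβP : ∀ n, P.unfoldNode (β n) ∈ P.tree := fun n => by
    obtain ⟨k, hk⟩ := hmem n
    exact hmemP k _ hk
  obtain ⟨N, hN⟩ := H β h0 hβ hβP
  -- A bad bud far out on `β` is longer than every word of `P.tree`, so `comp` has picked its
  -- companion. But by `H` a good companion was available.
  obtain ⟨M, hM⟩ : ∃ M, ∀ w ∈ P.tree, w.length < M := by
    obtain ⟨M, hM⟩ := (P.finite.image List.length).bddAbove
    exact ⟨M + 1, fun w hw => Nat.lt_succ_of_le (hM ⟨w, hw, rfl⟩)⟩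
  obtain ⟨n, hn, k, hk⟩ := hinf (max N M)
  have hbud := (hx k).bud
  have hgood : ∃ d, Good (t (x k)) d := by
    rw [show t (x k) = β n from hk]
    refine hN n (le_trans (le_max_left _ _) hn) ?_
    rw [← show t (x k) = β n from hk, (x k).2.2.1.back_bud _ _ hbud]
    simp
  rcases (x k).2.2.2 _ _ hbud with h | h
  · have h1 := hM _ h
    have h2 : (t (x k)).length = n := by
      rw [show t (x k) = β n from hk, branch_length h0 hβ]
    have := (le_max_right N M).trans hn
    omega
  · refine hbad (x k) ?_
    rw [h]
    exact hcomp' _ hgood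

/-! ### Addresses of annotated nodes -/

/-- The address of the `j`-th annotated copy of the node `w`, if below each node there are `k`
structural rules. -/
def addr (k : ℕ) (w : List ℕ) (j : ℕ) : List ℕ :=
  w.flatMap (fun i => List.replicate k 0 ++ [i]) ++ List.replicate j 0

/-- The inverse of `addr`. -/
def unaddr (k : ℕ) (v : List ℕ) : List ℕ × ℕ :=
  v.foldl (fun p i => if p.2 = k then (p.1 ++ [i], 0) else (p.1, p.2 + 1)) ([], 0)

section Addr

variable {k : ℕ}

@[simp]
theorem addr_nil_zero : addr k [] 0 = [] := rfl

theorem addr_succ (w : List ℕ) (j : ℕ) : addr k w (j + 1) = addr k w j ++ [0] := by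
  simp [addr, List.replicate_succ']

theorem addr_concat_zero (w : List ℕ) (i : ℕ) : addr k (w ++ [i]) 0 = addr k w k ++ [i] := by
  simp [addr]

theorem unaddr_concat (v : List ℕ) (i : ℕ) : unaddr k (v ++ [i]) =
    if (unaddr k v).2 = k then ((unaddr k v).1 ++ [i], 0)
      else ((unaddr k v).1, (unaddr k v).2 + 1) := by
  rw [unaddr, List.foldl_append]
  rfl

/-- This is induction along the annotated path: through the `k` structural steps at a node and then
on to a child. -/
theorem addr_induction {p : List ℕ → ℕ → Prop} (h0 : p [] 0)
    (hsucc : ∀ w j, j < k → p w j → p w (j + 1)) (hconcat : ∀ w i, p w k → p (w ++ [i]) 0)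
    (w : List ℕ) (j : ℕ) (hj : j ≤ k) : p w j := by
  have key : ∀ w, p w 0 → ∀ j ≤ k, p w j := by
    intro w hw j
    induction j with
    | zero => exact fun _ => hw
    | succ j ih => exact fun hj => hsucc w j hj (ih (by omega))
  refine key w ?_ j hj
  induction w using List.reverseRecOn with
  | nil => exact h0
  | append_singleton w i ih => exact hconcat w i (key w ih k le_rfl)

theorem unaddr_addr (w : List ℕ) (j : ℕ) (hj : j ≤ k) : unaddr k (addr k w j) = (w, j) := by
  refine addr_induction (k := k) (p := fun w j => unaddr k (addr k w j) = (w, j)) rfl ?_ ?_ w j hj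
  · intro w j hj h
    rw [addr_succ, unaddr_concat, h, if_neg hj.ne]
  · intro w i h
    rw [addr_concat_zero, unaddr_concat, h, if_pos rfl]

theorem addr_inj {w w' : List ℕ} {j j' : ℕ} (hj : j ≤ k) (hj' : j' ≤ k)
    (h : addr k w j = addr k w' j') : w = w' ∧ j = j' := by
  have := unaddr_addr w j hj
  rw [h, unaddr_addr w' j' hj'] at this
  simpa [eq_comm] using this

theorem unaddr_prefix {v v' : List ℕ} (h : v <+: v') : (unaddr k v).1 <+: (unaddr k v').1 := by
  obtain ⟨u, rfl⟩ := h
  induction u using List.reverseRecOn with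
  | nil => simp
  | append_singleton u i ih =>
    refine ih.trans ?_
    rw [← List.append_assoc, unaddr_concat]
    split_ifs
    · exact List.prefix_append _ _
    · exact List.prefix_rfl

theorem exists_of_prefix_addr (w : List ℕ) (j : ℕ) (hj : j ≤ k) {s : List ℕ}
    (h : s <+: addr k w j) :
    ∃ u l, l ≤ k ∧ s = addr k u l ∧ u <+: w ∧ (u = w → l ≤ j) := by
  revert s
  refine addr_induction (k := k) (p := fun w j => ∀ {s : List ℕ}, s <+: addr k w j →
    ∃ u l, l ≤ k ∧ s = addr k u l ∧ u <+: w ∧ (u = w → l ≤ j)) ?_ ?_ ?_ w j hj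
  · intro s hs
    refine ⟨[], 0, by omega, by simpa using hs, List.prefix_rfl, fun _ => le_rfl⟩
  · intro w j hj ih s hs
    rw [addr_succ] at hs
    rcases List.prefix_concat_iff.1 hs with rfl | hs
    · exact ⟨w, j + 1, hj, (addr_succ w j).symm, List.prefix_rfl, fun _ => le_rfl⟩
    · obtain ⟨u, l, h1, h2, h3, h4⟩ := ih hs
      exact ⟨u, l, h1, h2, h3, fun h => (h4 h).trans (by omega)⟩
  · intro w i ih s hs
    rw [addr_concat_zero] at hs
    rcases List.prefix_concat_iff.1 hs with rfl | hs
    · exact ⟨w ++ [i], 0, by omega, (addr_concat_zero w i).symm, List.prefix_rfl, fun _ => le_rfl⟩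
    · obtain ⟨u, l, h1, h2, h3, -⟩ := ih hs
      refine ⟨u, l, h1, h2, h3.trans (List.prefix_append _ _), ?_⟩
      rintro rfl
      have := h3.length_le
      simp at this

theorem addr_prefix_of_lt {w w' : List ℕ} {i : ℕ} (h : w ++ [i] <+: w') {j : ℕ} (hj : j ≤ k) :
    addr k w j <+: addr k w' 0 := by
  obtain ⟨u, rfl⟩ := h
  have h1 : addr k w j <+: addr k w k := by
    refine (List.prefix_append_right_inj _).2 ?_
    rw [← Nat.add_sub_of_le hj, List.replicate_add]
    exact List.prefix_append _ _
  refine (h1.trans (List.prefix_append _ [i])).trans ?_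
  rw [← addr_concat_zero]
  simp [addr]

theorem addr_prefix_zero {w w' : List ℕ} (h : w <+: w') (j : ℕ) : addr k w 0 <+: addr k w' j := by
  obtain ⟨u, rfl⟩ := h
  simp [addr]

end Addr

/-! ### Annotating a preproof -/

section Annotate

universe u v w a c

variable {D : DerivationSystem.{u, v}} {A : Type a} [ActivationAlgebra A] {C : Type c}
  {I : TraceInterpretation.{u, v, w} D A}

theorem ResetRule.IsStructural.arity {r : ResetRule C I} (h : r.IsStructural) :
    (resetDerivation C I).arity r = 1 := by
  cases r with
  | weak => rfl
  | reset => rfl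
  | pop => rfl
  | app => exact h.elim

/-- The data of an annotation of the preproof `Q`: for each node `w` there is a series of `k`
structural rules `ρ w j` with conclusions `L w j`, followed by the rule `ρ w k` at `w`. -/
structure IsAnnotation (Q : Preproof D) (k : ℕ)
    (L : List ℕ → ℕ → Σ Γ : D.Seq, Board C (I.obj Γ)) (ρ : List ℕ → ℕ → ResetRule C I) :
    Prop where
  label : ∀ w ∈ Q.tree, ∀ j, (L w j).1 = Q.label w
  back : ∀ w d, Q.back w = some d → L w 0 = L d 0
  structural : ∀ w ∈ Q.tree, Q.back w = none → ∀ j < k, (ρ w j).IsStructural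
  app : ∀ w ∈ Q.tree, Q.back w = none → ∃ r b bs h, ρ w k = .app r b bs h ∧ Q.rule w = some r
  concl : ∀ w ∈ Q.tree, Q.back w = none → ∀ j ≤ k, (resetDerivation C I).concl (ρ w j) = L w j
  prem : ∀ w ∈ Q.tree, Q.back w = none → ∀ j < k, ∀ i,
    (resetDerivation C I).prem (ρ w j) i = L w (j + 1)
  prem_app : ∀ w ∈ Q.tree, Q.back w = none → ∀ i : Fin ((resetDerivation C I).arity (ρ w k)),
    (resetDerivation C I).prem (ρ w k) i = L (w ++ [i.val]) 0

variable {Q : Preproof D} {k : ℕ} {L : List ℕ → ℕ → Σ Γ : D.Seq, Board C (I.obj Γ)}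
  {ρ : List ℕ → ℕ → ResetRule C I}

/-- The tree of an annotated preproof. -/
def annotatedTree (Q : Preproof D) (k : ℕ) : Set (List ℕ) :=
  {v | ∃ w ∈ Q.tree, ∃ j ≤ k, (Q.back w ≠ none → j = 0) ∧ v = addr k w j}

theorem addr_mem_annotatedTree {w : List ℕ} {j : ℕ} (hj : j ≤ k) :
    addr k w j ∈ annotatedTree Q k ↔ w ∈ Q.tree ∧ (Q.back w ≠ none → j = 0) := by
  constructor
  · rintro ⟨w', hw', j', hj', h, e⟩
    obtain ⟨rfl, rfl⟩ := addr_inj hj hj' e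
    exact ⟨hw', h⟩
  · rintro ⟨h1, h2⟩
    exact ⟨w, h1, j, hj, h2, rfl⟩

theorem addr_concat_mem_annotatedTree {w : List ℕ} (hw : w ∈ Q.tree) {j : ℕ}
    (hj : j < k) (hb : Q.back w = none) {i : ℕ} :
    addr k w j ++ [i] ∈ annotatedTree Q k ↔ i = 0 := by
  constructor
  · rintro ⟨w', hw', j', hj', h, e⟩
    have h1 := unaddr_concat (k := k) (addr k w j) i
    rw [e, unaddr_addr w' j' hj', unaddr_addr w j hj.le, if_neg hj.ne] at h1
    simp only [Prod.mk.injEq] at h1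
    obtain ⟨rfl, rfl⟩ := h1
    rw [addr_succ] at e
    simpa using e
  · rintro rfl
    rw [← addr_succ, addr_mem_annotatedTree (by omega)]
    exact ⟨hw, fun h => absurd hb h⟩

theorem addr_k_concat_mem_annotatedTree {w : List ℕ} {i : ℕ} :
    addr k w k ++ [i] ∈ annotatedTree Q k ↔ w ++ [i] ∈ Q.tree := by
  rw [← addr_concat_zero, addr_mem_annotatedTree (by omega)]
  simp

open Classical in
/-- The preproof obtained by an annotation. -/
noncomputable def annotate (h : IsAnnotation Q k L ρ) : Preproof (resetDerivation C I) where
  tree := annotatedTree Q k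
  finite := by
    refine (Set.Finite.image2 (addr k) Q.finite (Set.finite_Iic k)).subset ?_
    rintro v ⟨w, hw, j, hj, -, rfl⟩
    exact ⟨w, hw, j, hj, rfl⟩
  root_mem := ⟨[], Q.root_mem, 0, by omega, by simp, rfl⟩
  prefix_closed := by
    rintro s _ hs ⟨w, hw, j, hj, h, rfl⟩
    obtain ⟨u, l, hl, rfl, hu, h'⟩ := exists_of_prefix_addr w j hj hs
    refine ⟨u, Q.prefix_closed _ _ hu hw, l, hl, fun hb => ?_, rfl⟩
    by_cases e : u = w
    · have h1 := h' e
      have h2 := h (e ▸ hb)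
      omega
    · exact absurd (Preproof.back_eq_none_of_prefix hw hu e) hb
  back v := if v ∈ annotatedTree Q k then (Q.back (unaddr k v).1).map fun d => addr k d 0 else none
  bud_leaf := by
    intro v c hc
    split_ifs at hc with hv
    refine ⟨hv, fun i hi => ?_⟩
    obtain ⟨w, hw, j, hj, h, rfl⟩ := hv
    rw [unaddr_addr w j hj] at hc
    obtain ⟨d, hd, rfl⟩ := Option.map_eq_some_iff.1 hc
    obtain rfl := h (by simp [hd])
    -- For `k = 0` a word one letter longer would address a child of `w` in `Q`. Otherwise it would
    -- address copy `1` of `w`, which a bud does not have.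
    by_cases hk : k = 0
    · subst hk
      exact (Q.bud_leaf w d hd).2 i (addr_k_concat_mem_annotatedTree.1 hi)
    · obtain ⟨w', hw', j', hj', h', e⟩ := hi
      have h1 := unaddr_concat (k := k) (addr k w 0) i
      rw [e, unaddr_addr w' j' hj', unaddr_addr w 0 hj, if_neg (by simpa using Ne.symm hk)] at h1
      simp only [Prod.mk.injEq] at h1
      obtain ⟨rfl, rfl⟩ := h1
      have := h' (by simp [hd])
      omega
  companion_lt := by
    intro v c hc
    split_ifs at hc with hv
    obtain ⟨w, hw, j, hj, h, rfl⟩ := hv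
    rw [unaddr_addr w j hj] at hc
    obtain ⟨d, hd, rfl⟩ := Option.map_eq_some_iff.1 hc
    refine ⟨addr_prefix_zero (Q.companion_lt w d hd).1 j, fun e => ?_⟩
    exact (Q.companion_lt w d hd).2 (addr_inj (by omega) hj e).1
  label v := L (unaddr k v).1 (unaddr k v).2
  rule v := if v ∈ annotatedTree Q k ∧ Q.back (unaddr k v).1 = none then
    some (ρ (unaddr k v).1 (unaddr k v).2) else none
  label_back := by
    intro v c hc
    split_ifs at hc with hv
    obtain ⟨w, hw, j, hj, h', rfl⟩ := hv
    rw [unaddr_addr w j hj] at hc ⊢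
    obtain ⟨d, hd, rfl⟩ := Option.map_eq_some_iff.1 hc
    obtain rfl := h' (by simp [hd])
    rw [unaddr_addr d 0 (by omega)]
    exact h.back w d hd
  rule_dom := by
    intro v r hr
    split_ifs at hr with hv
    refine ⟨hv.1, ?_⟩
    simp [hv.2]
  rule_concl := by
    intro v r hr
    split_ifs at hr with hv
    obtain ⟨⟨w, hw, j, hj, h', rfl⟩, hb⟩ := hv
    rw [unaddr_addr w j hj] at hr hb ⊢
    cases hr
    exact (h.concl w hw hb j hj).symm
  rule_children := by
    intro v r hr i
    split_ifs at hr with hv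
    obtain ⟨⟨w, hw, j, hj, h', rfl⟩, hb⟩ := hv
    rw [unaddr_addr w j hj] at hr hb
    cases hr
    rcases hj.lt_or_eq with hj | rfl
    · rw [addr_concat_mem_annotatedTree hw hj hb, (h.structural w hw hb j hj).arity]
      omega
    · rw [addr_k_concat_mem_annotatedTree]
      obtain ⟨r, b, bs, hs, e, hr⟩ := h.app w hw hb
      rw [Q.rule_children w r hr i]
      simp only [e]
      exact Iff.rfl
  rule_prem := by
    intro v r hr i
    split_ifs at hr with hv
    obtain ⟨⟨w, hw, j, hj, h', rfl⟩, hb⟩ := hv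
    rw [unaddr_addr w j hj] at hr hb
    cases hr
    rcases hj.lt_or_eq with hj | rfl
    · have hi : i.val = 0 := by
        have := i.2
        have h1 : (resetDerivation C I).arity (ρ (w, j).1 (w, j).2) = 1 :=
          (h.structural w hw hb j hj).arity
        omega
      rw [hi, ← addr_succ, unaddr_addr w (j + 1) hj]
      exact (h.prem w hw hb j hj i).symm
    · rw [← addr_concat_zero, unaddr_addr _ 0 (by omega)]
      exact (h.prem_app w hw hb i).symm
  leaf_of_no_rule := by
    intro v hv hr i hi
    obtain ⟨w, hw, j, hj, h', rfl⟩ := hv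
    have hb : Q.back w ≠ none := by
      intro hb
      rw [if_pos] at hr
      · cases hr
      · rw [unaddr_addr w j hj]
        exact ⟨⟨w, hw, j, hj, h', rfl⟩, hb⟩
    obtain rfl := h' hb
    obtain ⟨d, hd⟩ := Option.ne_none_iff_exists'.1 hb
    by_cases hk : k = 0
    · subst hk
      exact (Q.bud_leaf w d hd).2 i (addr_k_concat_mem_annotatedTree.1 hi)
    · obtain ⟨w', hw', j', hj', h', e⟩ := hi
      have h1 := unaddr_concat (k := k) (addr k w 0) i
      rw [e, unaddr_addr w' j' hj', unaddr_addr w 0 hj, if_neg (by simpa using Ne.symm hk)] at h1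
      simp only [Prod.mk.injEq] at h1
      obtain ⟨rfl, rfl⟩ := h1
      have := h' hb
      omega

variable (h : IsAnnotation Q k L ρ)

include h

theorem annotate_label_addr {w : List ℕ} {j : ℕ} (hj : j ≤ k) :
    (annotate h).label (addr k w j) = L w j := by
  simp only [annotate]
  rw [unaddr_addr w j hj]

theorem annotate_rule_addr {w : List ℕ} {j : ℕ} (hj : j ≤ k) (hw : w ∈ Q.tree)
    (hb : Q.back w = none) : (annotate h).rule (addr k w j) = some (ρ w j) := by
  simp only [annotate]
  rw [unaddr_addr w j hj]
  refine if_pos ?_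
  exact ⟨(addr_mem_annotatedTree hj).2 ⟨hw, fun h => absurd hb h⟩, hb⟩

theorem annotate_back_addr {w d : List ℕ} (hd : Q.back w = some d) :
    (annotate h).back (addr k w 0) = some (addr k d 0) := by
  simp only [annotate]
  rw [unaddr_addr w 0 (by omega), if_pos, hd]
  · rfl
  · exact (addr_mem_annotatedTree (by omega)).2 ⟨(Q.bud_leaf w d hd).1, fun _ => rfl⟩

theorem exists_of_annotate_back {v c : List ℕ} (hv : (annotate h).back v = some c) :
    ∃ w d, Q.back w = some d ∧ v = addr k w 0 ∧ c = addr k d 0 := by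
  simp only [annotate] at hv
  split_ifs at hv with hm
  obtain ⟨w, hw, j, hj, h', rfl⟩ := hm
  rw [unaddr_addr w j hj] at hv
  obtain ⟨d, hd, rfl⟩ := Option.map_eq_some_iff.1 hv
  obtain rfl := h' (by simp [hd])
  exact ⟨w, d, hd, rfl, rfl⟩

theorem exists_of_annotate_rule {v : List ℕ} {r : ResetRule C I}
    (hv : (annotate h).rule v = some r) :
    ∃ w ∈ Q.tree, ∃ j ≤ k, Q.back w = none ∧ v = addr k w j ∧ r = ρ w j := by
  simp only [annotate] at hv
  split_ifs at hv with hm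
  obtain ⟨⟨w, hw, j, hj, h', rfl⟩, hb⟩ := hm
  rw [unaddr_addr w j hj] at hv hb
  cases hv
  exact ⟨w, hw, j, hj, hb, rfl, rfl⟩

omit h in
open Classical in
theorem stripFrom_append (P : Preproof (resetDerivation C I)) (s u v : List ℕ) :
    stripFrom P s (u ++ v) = stripFrom P s u ++ stripFrom P (s ++ u) v := by
  induction u generalizing s with
  | nil => simp [stripFrom]
  | cons i u ih =>
    simp only [List.cons_append, stripFrom, ih]
    split_ifs <;> simp

omit h in
open Classical in
theorem stripNode_concat (P : Preproof (resetDerivation C I)) (v : List ℕ) (i : ℕ) :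
    stripNode P (v ++ [i]) = stripNode P v ++
      if ∃ r : ResetRule C I, P.rule v = some r ∧ r.IsStructural then [] else [i] := by
  rw [stripNode, stripFrom_append, stripNode]
  simp only [stripFrom, List.nil_append]

/-- The rules at the copies `j < k` are structural and the rule at copy `k` is not, so exactly the
padding zeros are deleted. -/
theorem stripNode_annotate {w : List ℕ} {j : ℕ} (hj : j ≤ k)
    (hw : addr k w j ∈ annotatedTree Q k) : stripNode (annotate h) (addr k w j) = w := by
  classical
  revert hw
  refine addr_induction (k := k) (p := fun w j => addr k w j ∈ annotatedTree Q k →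
    stripNode (annotate h) (addr k w j) = w) (fun _ => rfl) ?_ ?_ w j hj
  · intro w j hj ih hw
    obtain ⟨h1, h2⟩ := (addr_mem_annotatedTree (by omega)).1 hw
    have hb : Q.back w = none := by
      by_contra hb
      exact absurd (h2 hb) (by omega)
    rw [addr_succ, stripNode_concat, ih ((addr_mem_annotatedTree hj.le).2
      ⟨h1, fun h => absurd hb h⟩), if_pos, List.append_nil]
    exact ⟨_, annotate_rule_addr h hj.le h1 hb, h.structural w h1 hb j hj⟩
  · intro w i ih hw
    have hwi := ((addr_mem_annotatedTree (by omega)).1 hw).1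
    have h1 := Q.prefix_closed _ _ (List.prefix_append w [i]) hwi
    have hb := Preproof.back_eq_none_of_child hwi
    rw [addr_concat_zero, stripNode_concat, ih ((addr_mem_annotatedTree le_rfl).2
      ⟨h1, fun h => absurd hb h⟩), if_neg]
    rintro ⟨r, hr, hs⟩
    rw [annotate_rule_addr h le_rfl h1 hb] at hr
    cases hr
    obtain ⟨r, b, bs, h', e, -⟩ := h.app w h1 hb
    rw [e] at hs
    exact hs

theorem isStrip_annotate : IsStrip (annotate h) Q where
  tree := by
    ext w
    constructor
    · intro hw
      have hm : addr k w 0 ∈ annotatedTree Q k :=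
        (addr_mem_annotatedTree (by omega)).2 ⟨hw, fun _ => rfl⟩
      exact ⟨addr k w 0, hm, stripNode_annotate h (by omega) hm⟩
    · rintro ⟨v, hv, rfl⟩
      obtain ⟨w, hw, j, hj, -, rfl⟩ := id hv
      rwa [stripNode_annotate h hj hv]
  label v hv := by
    obtain ⟨w, hw, j, hj, -, rfl⟩ := id hv
    rw [stripNode_annotate h hj hv, annotate_label_addr h hj, h.label w hw]
  rule s r := by
    constructor
    · intro hr
      obtain ⟨hs, hb⟩ := Q.rule_dom s r hr
      obtain ⟨r', b, bs, h', e, hr'⟩ := h.app s hs hb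
      rw [hr] at hr'
      cases hr'
      refine ⟨addr k s k, b, bs, h', stripNode_annotate h le_rfl
        ((addr_mem_annotatedTree le_rfl).2 ⟨hs, fun h => absurd hb h⟩), ?_⟩
      rw [annotate_rule_addr h le_rfl hs hb, e]
    · rintro ⟨v, b, bs, h', rfl, hv⟩
      obtain ⟨w, hw, j, hj, hb, rfl, e⟩ := exists_of_annotate_rule h hv
      rw [stripNode_annotate h hj ((addr_mem_annotatedTree hj).2 ⟨hw, fun h => absurd hb h⟩)]
      rcases hj.lt_or_eq with hj | rfl
      · have := h.structural w hw hb j hj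
        rw [← e] at this
        exact this.elim
      · obtain ⟨r', b', bs', h'', e', hr⟩ := h.app w hw hb
        rw [e'] at e
        cases e
        exact hr
  back s d := by
    have hstrip : ∀ w d, Q.back w = some d → stripNode (annotate h) (addr k w 0) = w ∧
        stripNode (annotate h) (addr k d 0) = d := by
      intro w d hd
      have hw := (Q.bud_leaf w d hd).1
      exact ⟨stripNode_annotate h (by omega)
        ((addr_mem_annotatedTree (by omega)).2 ⟨hw, fun _ => rfl⟩),
        stripNode_annotate h (by omega) ((addr_mem_annotatedTree (by omega)).2
          ⟨Q.prefix_closed _ _ (Q.companion_lt w d hd).1 hw, fun _ => rfl⟩)⟩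
    constructor
    · intro hd
      exact ⟨_, _, (hstrip s d hd).1, (hstrip s d hd).2, annotate_back_addr h hd⟩
    · rintro ⟨v, c, rfl, rfl, hv⟩
      obtain ⟨w, d, hd, rfl, rfl⟩ := exists_of_annotate_back h hv
      rw [(hstrip w d hd).1, (hstrip w d hd).2, hd]

/-- The path from a companion to its bud consists of all copies of the nodes `u` from `d` to `w`,
except that the bud `w` has only copy `0`. The invariant can therefore be stated in terms of `L` and
`ρ` on `Q`. -/
theorem annotate_mem_proofs
    (hinv : ∀ w d, Q.back w = some d → ∃ θ γ, θ.getLast? = some γ ∧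
      (∀ u, d <+: u → u <+: w → u ≠ w → ∀ j ≤ k, θ <+: (L u j).2.control) ∧
      θ <+: (L w 0).2.control ∧
      ∃ u, d <+: u ∧ u <+: w ∧ u ≠ w ∧ ∃ j < k, ∃ Γ b b' hr, ρ u j = .reset γ Γ b b' hr) :
    annotate h ∈ (resetSystem C I).proofs := by
  refine ⟨?_, ?_⟩
  · intro v hv hb
    obtain ⟨w, hw, j, hj, h', rfl⟩ := id hv
    refine ⟨_, annotate_rule_addr h hj hw ?_⟩
    rcases hd : Q.back w with _ | d
    · rfl
    · obtain rfl := h' (by simp [hd])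
      rw [annotate_back_addr h hd] at hb
      cases hb
  · intro v c hv
    obtain ⟨w, d, hd, rfl, rfl⟩ := exists_of_annotate_back h hv
    have hw := (Q.bud_leaf w d hd).1
    obtain ⟨θ, γ, h1, h2, h3, u, hdu, huw, hne, j, hj, Γ, b, b', hr, e⟩ := hinv w d hd
    refine ⟨θ, ?_, γ, h1, addr k u j, addr_prefix_zero hdu j, ?_, ?_, Γ, b, b', hr, ?_⟩
    · intro s hs1 hs2
      obtain ⟨u, l, hl, rfl, hu, h'⟩ := exists_of_prefix_addr w 0 (by omega) hs2
      rw [annotate_label_addr h hl]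
      by_cases e : u = w
      · obtain rfl : l = 0 := by have := h' e; omega
        rw [e]
        exact h3
      · have := unaddr_prefix (k := k) hs1
        rw [unaddr_addr d 0 (by omega), unaddr_addr u l hl] at this
        exact h2 u this hu e l hl
    · obtain ⟨x, rfl⟩ := huw
      cases x with
      | nil => simp at hne
      | cons i x => exact addr_prefix_of_lt (i := i) ⟨x, by simp⟩ hj.le
    · exact fun e => hne (addr_inj hj.le (by omega) e).1
    · rw [annotate_rule_addr h hj.le (Q.prefix_closed _ _ huw hw)
        (Preproof.back_eq_none_of_prefix hw huw hne), e]

end Annotate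

/-! ### Resets along sequences of boards -/

theorem add_mul_div_mod {k j : ℕ} (hj : j ≤ k) (n : ℕ) :
    (j + (k + 1) * n) / (k + 1) = n ∧ (j + (k + 1) * n) % (k + 1) = j :=
  (Nat.div_mod_unique (Nat.succ_pos k)).2 ⟨rfl, by omega⟩

/-- A form of `exists_persistent_reset` where time is given by macro steps `n` that consist of
`k + 1` micro steps each. -/
theorem exists_stable_prefix_reset {C : Type*} [DecidableEq C] {k : ℕ} (hk : 1 ≤ k)
    (l : ℕ → ℕ → List C) (hl : ∀ n j, (l n j).Nodup) (F : Set C) (hF : F.Finite)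
    (hlF : ∀ n j, ∀ γ ∈ l n j, γ ∈ F) (o : ℕ → ℕ → Option C) (𝒮 : ℕ → ℕ → Set (Set C))
    (h𝒮 : ∀ n j, ∀ S ∈ 𝒮 n j, ∀ γ ∈ S, γ ∈ l n j) (h1 : (𝒮 0 1).Nonempty)
    (hc : ∀ n, ∀ j < k, ControlStep (l n j) (l n (j + 1)))
    (hck : ∀ n, ControlStep (l n k) (l (n + 1) 0))
    (hs : ∀ n, ∀ j < k, ∀ S ∈ 𝒮 n j, ∃ S' ∈ 𝒮 n (j + 1),
      StackStep (l n j) (l n (j + 1)) (o n j) S S') (g : ℕ → Prop)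
    (hsk : ∀ n, ∀ S ∈ 𝒮 n k, ∃ S' ∈ 𝒮 (n + 1) 0, StackStep (l n k) (l (n + 1) 0) none S S' ∧
      (g n → ∃ f ∈ S', f ∉ l n k))
    (hg : ∀ N, ∃ n ≥ N, g n) :
    ∃ θ γ, θ.getLast? = some γ ∧ (∃ N, ∀ n ≥ N, ∀ j ≤ k, θ <+: l n j) ∧
      ∀ N, ∃ n ≥ N, ∃ j < k, o n j = some γ := by
  -- The time `τ` stands for micro step `md τ` of macro step `dv τ`. Because of the shift by one, `τ
  -- = 0` is micro step `1` of macro step `0`, where `h1` provides a stack.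
  let dv : ℕ → ℕ := fun τ => (τ + 1) / (k + 1)
  let md : ℕ → ℕ := fun τ => (τ + 1) % (k + 1)
  have hdvmd : ∀ τ, md τ + (k + 1) * dv τ = τ + 1 ∧ md τ ≤ k := fun τ =>
    ⟨Nat.mod_add_div _ _, Nat.lt_succ_iff.1 (Nat.mod_lt _ (Nat.succ_pos k))⟩
  have hnext : ∀ τ, md τ < k ∧ dv (τ + 1) = dv τ ∧ md (τ + 1) = md τ + 1 ∨
      md τ = k ∧ dv (τ + 1) = dv τ + 1 ∧ md (τ + 1) = 0 := by
    intro τ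
    obtain ⟨h1, h2⟩ := hdvmd τ
    rcases h2.lt_or_eq with h | h
    · have := add_mul_div_mod (j := md τ + 1) h (dv τ)
      rw [show md τ + 1 + (k + 1) * dv τ = τ + 1 + 1 by omega] at this
      exact Or.inl ⟨h, this⟩
    · have := add_mul_div_mod (j := 0) (Nat.zero_le k) (dv τ + 1)
      rw [show 0 + (k + 1) * (dv τ + 1) = τ + 1 + 1 by rw [mul_add]; omega] at this
      exact Or.inr ⟨h, this⟩
  let o' : ℕ → Option C := fun τ => if md τ < k then o (dv τ) (md τ) else none
  have hctrl : ∀ τ, ControlStep (l (dv τ) (md τ)) (l (dv (τ + 1)) (md (τ + 1))) := by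
    intro τ
    rcases hnext τ with ⟨h, e1, e2⟩ | ⟨h, e1, e2⟩
    · rw [e1, e2]; exact hc _ _ h
    · rw [e1, e2, h]; exact hck _
  have hstep : ∀ (τ : ℕ) (S : 𝒮 (dv τ) (md τ)), ∃ S' : 𝒮 (dv (τ + 1)) (md (τ + 1)),
      StackStep (l (dv τ) (md τ)) (l (dv (τ + 1)) (md (τ + 1))) (o' τ) S.1 S'.1 ∧
        (md τ = k → g (dv τ) → ∃ f ∈ S'.1, f ∉ l (dv τ) (md τ)) := by
    rintro τ ⟨S, hS⟩
    simp only [o']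
    rcases hnext τ with ⟨h, e1, e2⟩ | ⟨h, e1, e2⟩
    · rw [e1, e2, if_pos h]
      obtain ⟨S', hS', h'⟩ := hs _ _ h S hS
      exact ⟨⟨S', hS'⟩, h', fun e => absurd e h.ne⟩
    · rw [h] at hS
      rw [e1, e2, h, if_neg (lt_irrefl k)]
      obtain ⟨S', hS', h', h''⟩ := hsk _ S hS
      exact ⟨⟨S', hS'⟩, h', fun _ => h''⟩
  have hstart : (𝒮 (dv 0) (md 0)).Nonempty := by
    have := add_mul_div_mod hk 0
    simp only [mul_zero, add_zero] at this
    simp only [dv, md, this.1, this.2]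
    exact h1
  obtain ⟨S₀, hS₀⟩ := hstart
  choose f hf using hstep
  let S : (τ : ℕ) → 𝒮 (dv τ) (md τ) := fun τ => Nat.rec ⟨S₀, hS₀⟩ (fun τ S => f τ S) τ
  have hS : ∀ τ, S (τ + 1) = f τ (S τ) := fun _ => rfl
  obtain ⟨γ, ⟨N, hN⟩, hγ⟩ := exists_persistent_reset (fun τ => l (dv τ) (md τ))
    (fun _ => hl _ _) hctrl F hF (fun _ => hlF _ _) o' (fun τ => (S τ).1)
    (fun τ => h𝒮 _ _ _ (S τ).2) (fun τ => by rw [hS]; exact (hf τ (S τ)).1)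
    (by
      intro N
      obtain ⟨n, hn, hgn⟩ := hg (N + 1)
      have h := add_mul_div_mod (le_refl k) n
      have hge : n ≤ (k + 1) * n := Nat.le_mul_of_pos_left n (Nat.succ_pos k)
      obtain ⟨τ, hτ⟩ : ∃ τ, k + (k + 1) * n = τ + 1 := ⟨k + (k + 1) * n - 1, by omega⟩
      rw [hτ] at h
      refine ⟨τ, by omega, ?_⟩
      rw [hS]
      exact (hf τ (S τ)).2 h.2 (by simpa only [dv, h.1] using hgn))
  obtain ⟨θ, hθ, N', hN'⟩ := exists_stable_prefix (fun τ => l (dv τ) (md τ)) (fun _ => hl _ _)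
    hctrl hN
  refine ⟨θ, γ, hθ, ⟨N' + 1, fun n hn j hj => ?_⟩, fun M => ?_⟩
  · have h := add_mul_div_mod hj n
    have hge : n ≤ (k + 1) * n := Nat.le_mul_of_pos_left n (Nat.succ_pos k)
    obtain ⟨τ, hτ⟩ : ∃ τ, j + (k + 1) * n = τ + 1 := ⟨j + (k + 1) * n - 1, by omega⟩
    rw [hτ] at h
    have := hN' τ (by omega)
    simpa only [dv, md, h.1, h.2] using this
  · obtain ⟨τ, hτ, h⟩ := hγ ((k + 1) * M)
    simp only [o'] at h
    split_ifs at h with hlt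
    exact ⟨dv τ, (Nat.le_div_iff_mul_le (Nat.succ_pos k)).2
      (by rw [mul_comm]; exact le_trans hτ (Nat.le_succ τ)), md τ, hlt, h⟩

/-! ### Threads -/

section Thread

variable {A : Type*} [ActivationAlgebra A]

/-- The functor turns a composite of steps into a composite of relations, so a trace splits into
single steps. The last clause expresses that the join of the labels `c t` is `a`, in the form needed
for a running join `e` with an arbitrary initial value. -/
theorem exists_path {G : ℕ ⥤ TraceCat A} {m n : ℕ} (hmn : m ≤ n) {x : (G.obj m).carrier} {a : A}
    {z : (G.obj n).carrier} (h : (x, a, z) ∈ TraceHom.rel (G.map (homOfLE hmn))) :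
    ∃ (y : (t : ℕ) → m ≤ t → t ≤ n → (G.obj t).carrier) (c : ℕ → A),
      y m le_rfl hmn = x ∧ y n hmn le_rfl = z ∧
      (∀ t (h1 : m ≤ t) (h2 : t < n), (y t h1 h2.le, c t, y (t + 1) (by omega) h2) ∈
        TraceHom.rel (G.map (homOfLE (Nat.le_succ t)))) ∧
      (∀ t, m ≤ t → t < n → c t ≤ a) ∧
      ∀ e : ℕ → A, (∀ t, m ≤ t → t < n → e (t + 1) = e t ⊔ c t) → e n = e m ⊔ a := by
  induction n, hmn using Nat.le_induction generalizing a with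
  | base =>
    have hid : homOfLE (le_refl m) = 𝟙 m := rfl
    rw [hid, G.map_id] at h
    obtain ⟨h1, h2⟩ := h
    dsimp only at h1 h2
    subst h1 h2
    refine ⟨fun t h1 h2 => (le_antisymm h1 h2) ▸ x, fun _ => ⊥, rfl, rfl, ?_, ?_, ?_⟩
    · intro t h1 h2; omega
    · intro t h1 h2; omega
    · intro e _; simp
  | succ n hmn ih =>
    have hcomp : homOfLE (Nat.le_succ_of_le hmn) = homOfLE hmn ≫ homOfLE (Nat.le_succ n) := rfl
    rw [show homOfLE _ = homOfLE hmn ≫ homOfLE (Nat.le_succ n) from hcomp, G.map_comp] at h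
    obtain ⟨w, a', b, h1, h2, h3⟩ := h
    dsimp only at h1 h2 h3
    subst h3
    obtain ⟨y, c, hy1, hy2, hy3, hc, he⟩ := ih h1
    refine ⟨fun t h1 h2 => if h : t ≤ n then y t h1 h else (show n + 1 = t by omega) ▸ z,
      fun t => if t < n then c t else b, ?_, ?_, ?_, ?_, ?_⟩
    · simp [hmn, hy1]
    · simp
    · intro t ht1 ht2
      by_cases hlt : t < n
      · simp only [hlt, if_true, hlt.le, Nat.succ_le_of_lt hlt, dif_pos]
        exact hy3 t ht1 hlt
      · obtain rfl : t = n := by omega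
        simpa [hy2] using h2
    · intro t ht1 ht2
      dsimp only
      split_ifs with hlt
      · exact (hc t ht1 hlt).trans le_sup_left
      · exact le_sup_right
    · intro e hee
      have h4 : e n = e m ⊔ a' := he e fun t ht1 ht2 => by
        have := hee t ht1 (by omega)
        dsimp only at this
        rwa [if_pos ht2] at this
      have h5 := hee n hmn (by omega)
      dsimp only at h5
      rw [if_neg (lt_irrefl n)] at h5
      rw [h5, h4, sup_assoc]

/-- The trace condition in terms of single steps. -/
theorem exists_thread {G : ℕ ⥤ TraceCat A} (hG : TraceCondition G) :
    ∃ (t₀ : ℕ) (y : (t : ℕ) → t₀ ≤ t → (G.obj t).carrier) (c : ℕ → A),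
      (∀ t (h : t₀ ≤ t), (y t h, c t, y (t + 1) (by omega)) ∈
        TraceHom.rel (G.map (homOfLE (Nat.le_succ t)))) ∧
      (∀ t ≥ t₀, c t ≤ ActivationAlgebra.act) ∧
      ∀ T, ∃ T₁ ≥ T, t₀ ≤ T₁ ∧ ∃ T₂ ≥ T₁, ∀ e : ℕ → A,
        (∀ t, T₁ ≤ t → t < T₂ → e (t + 1) = e t ⊔ c t) →
          e T₂ = e T₁ ⊔ ActivationAlgebra.act := by
  classical
  obtain ⟨S, hS, x, hx⟩ := hG
  -- The segments from `S i` to `S (i + 1)` are split into single steps and glued: `i t` below is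
  -- the segment containing `t`, and adjacent segments agree at their common endpoint.
  choose y c hy1 hy2 hy3 hc he using fun i => exists_path _ (hx i)
  have hex : ∀ t, S 0 ≤ t → ∃ i, S i ≤ t ∧ t < S (i + 1) := by
    intro t ht
    have hex : ∃ n, t < S n := ⟨t + 1, lt_of_lt_of_le (Nat.lt_succ_self t) hS.le_apply⟩
    obtain ⟨i, hi⟩ : ∃ i, Nat.find hex = i + 1 := by
      refine ⟨Nat.find hex - 1, ?_⟩
      rcases h : Nat.find hex with _ | i
      · have := Nat.find_spec hex
        rw [h] at this
        omega
      · simp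
    have h1 := Nat.find_spec hex
    rw [hi] at h1
    refine ⟨i, ?_, h1⟩
    by_contra h
    have := Nat.find_min' hex (not_le.1 h)
    omega
  have huniq : ∀ {t i j}, S i ≤ t → t < S (i + 1) → S j ≤ t → t < S (j + 1) → i = j := by
    intro t i j h1 h2 h3 h4
    have h5 := hS.lt_iff_lt.1 (h1.trans_lt h4)
    have h6 := hS.lt_iff_lt.1 (h3.trans_lt h2)
    omega
  choose! i hi1 hi2 using hex
  let y' : (t : ℕ) → S 0 ≤ t → (G.obj t).carrier := fun t h => y (i t) t (hi1 t h) (hi2 t h).le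
  have h0 : ∀ {j t}, S j ≤ t → S 0 ≤ t := fun h => (hS.monotone (Nat.zero_le _)).trans h
  have hieq : ∀ {j t}, S j ≤ t → t < S (j + 1) → i t = j := fun h1 h2 =>
    huniq (hi1 _ (h0 h1)) (hi2 _ (h0 h1)) h1 h2
  have hy'1 : ∀ j t (h1 : S j ≤ t) (h2 : t < S (j + 1)), y' t (h0 h1) = y j t h1 h2.le := by
    intro j t h1 h2
    obtain rfl := hieq h1 h2
    rfl
  have hy'2 : ∀ j t (h1 : S j ≤ t) (h2 : t ≤ S (j + 1)), y' t (h0 h1) = y j t h1 h2 := by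
    intro j t h1 h2
    rcases h2.lt_or_eq with h | rfl
    · exact hy'1 j t h1 h
    · rw [hy'1 (j + 1) _ le_rfl (hS (Nat.lt_succ_self _)), hy1]
      exact (hy2 j).symm
  refine ⟨S 0, y', fun t => c (i t) t, ?_, ?_, ?_⟩
  · intro t ht
    rw [hy'2 (i t) t (hi1 t ht) (hi2 t ht).le, hy'2 (i t) (t + 1) (by have := hi1 t ht; omega)
      (hi2 t ht)]
    exact hy3 (i t) t (hi1 t ht) (hi2 t ht)
  · intro t ht
    exact hc _ _ (hi1 t ht) (hi2 t ht)
  · intro T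
    refine ⟨S T, hS.le_apply, hS.monotone (Nat.zero_le _), S (T + 1),
      hS.monotone (Nat.le_succ T), fun e hee => he T e fun t h1 h2 => ?_⟩
    have := hee t h1 h2
    dsimp only at this
    rw [this, hieq h1 h2]

/-- The activation accumulated along a thread since it was last activated. -/
noncomputable def accumulate (c : ℕ → A) : ℕ → A
  | 0 => ⊥
  | n + 1 => open Classical in
    if accumulate c n ⊔ c n = ActivationAlgebra.act then ⊥ else accumulate c n ⊔ c n

theorem accumulate_ne (c : ℕ → A) (n : ℕ) : accumulate c n ≠ ActivationAlgebra.act := by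
  cases n with
  | zero => exact ActivationAlgebra.act_ne_bot.symm
  | succ n =>
    rw [accumulate]
    split_ifs with h
    · exact ActivationAlgebra.act_ne_bot.symm
    · exact h

theorem accumulate_le {c : ℕ → A} (hc : ∀ n, c n ≤ ActivationAlgebra.act) (n : ℕ) :
    accumulate c n ≤ ActivationAlgebra.act := by
  induction n with
  | zero => exact bot_le
  | succ n ih =>
    rw [accumulate]
    split_ifs with h
    · exact bot_le
    · exact sup_le ih (hc n)

end Thread

/-! ### Boards along the infinite unfolding -/

section Run

universe u v w a c

variable {D : DerivationSystem.{u, v}} {A : Type a} [ActivationAlgebra A] {C : Type c}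
  {I : TraceInterpretation.{u, v, w} D A}

/-- Apply `Board.tidy` to the board of a sequent. -/
noncomputable def tidySeq (s : Σ Γ : D.Seq, Board C (I.obj Γ)) (j : ℕ) :
    Σ Γ : D.Seq, Board C (I.obj Γ) := ⟨s.1, s.2.tidy j⟩

theorem exists_structural (s : Σ Γ : D.Seq, Board C (I.obj Γ)) (j : ℕ) :
    ∃ ρ : ResetRule C I, ρ.IsStructural ∧ (resetDerivation C I).concl ρ = tidySeq s j ∧
      (∀ i, (resetDerivation C I).prem ρ i = tidySeq s (j + 1)) ∧
      ∀ γ, s.2.tidyChip j = some γ → ∃ Γ b b' h, ρ = .reset γ Γ b b' h := by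
  obtain ⟨Γ, b⟩ := s
  rcases b.tidy_step j with ⟨γ, hγ, h⟩ | ⟨hγ, h | h⟩
  · refine ⟨.reset γ Γ _ _ h, trivial, rfl, fun _ => rfl, fun δ hδ => ?_⟩
    rw [hγ] at hδ
    cases hδ
    exact ⟨_, _, _, _, rfl⟩
  · exact ⟨.weak Γ _ _ h, trivial, rfl, fun _ => rfl, by simp [hγ]⟩
  · exact ⟨.pop Γ _ _ h, trivial, rfl, fun _ => rfl, by simp [hγ]⟩

/-- The sequent `s'` arises from the sequent `s` at the node `n` by tidying up its board and
passing to the `i`-th premise of the rule at `n`. -/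
def IsNext (P : Preproof D) (F : Finset C) (k : ℕ) (n : List ℕ)
    (s : Σ Γ : D.Seq, Board C (I.obj Γ)) (i : ℕ) (s' : Σ Γ : D.Seq, Board C (I.obj Γ)) : Prop :=
  ∃ (r : D.Rule) (hi : i < D.arity r) (b : Board C (I.obj (D.concl r)))
    (b' : Board C (I.obj (D.prem r ⟨i, hi⟩))), P.rule n = some r ∧ tidySeq s k = ⟨D.concl r, b⟩ ∧
      s' = ⟨D.prem r ⟨i, hi⟩, b'⟩ ∧ Board.Successor (I.mor r ⟨i, hi⟩) b b' ∧
      ∀ γ ∈ b'.control, γ ∈ F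

open Classical in
/-- The annotated sequents at the nodes of the infinite unfolding of `P`. -/
noncomputable def run (I : TraceInterpretation.{u, v, w} D A) (P : Preproof D) (F : Finset C)
    (k : ℕ) (w : List ℕ) : Σ Γ : D.Seq, Board C (I.obj Γ) :=
  List.reverseRecOn w ⟨P.label [], Board.empty C _⟩ fun w i s =>
    -- The default `s` is not used when the child belongs to the infinite unfolding and `F` and `k`
    -- suffice for a closed `P`, by `Suffices.isNext_run`.
    if h : ∃ s', IsNext P F k (P.resolve (P.unfoldNode w)) s i s' then h.choose else s

/-- There are enough chips in `F`, and `k` structural rules suffice to remove all covered chips. -/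
structure Suffices (I : TraceInterpretation.{u, v, w} D A) (P : Preproof D) (F : Finset C)
    (k M : ℕ) : Prop where
  card_le : ∀ s ∈ P.tree, Nat.card (I.obj (P.label s)).carrier ≤ M
  chips : M * Nat.card A + M ≤ F.card
  steps : M * Nat.card A * F.card + 2 ≤ k

variable {P : Preproof D} {F : Finset C} {k M : ℕ}

theorem run_nil : run I P F k [] = ⟨P.label [], Board.empty C _⟩ := by
  simp [run]

theorem run_concat {w : List ℕ} {i : ℕ}
    (h : ∃ s', IsNext P F k (P.resolve (P.unfoldNode w)) (run I P F k w) i s') :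
    IsNext P F k (P.resolve (P.unfoldNode w)) (run I P F k w) i (run I P F k (w ++ [i])) := by
  have e : run I P F k (w ++ [i]) = h.choose := by
    rw [run, List.reverseRecOn_concat]
    exact dif_pos h
  rw [e]
  exact h.choose_spec

/-- After `k` structural steps no chip is covered, so at most `M * Nat.card A` chips are in use.
This leaves `M` chips of `F`, enough for the fresh chips of a successor. -/
theorem Suffices.exists_isNext (hF : Suffices I P F k M) (hP : P.Closed) {n : List ℕ} {i : ℕ}
    (hn : n ++ [i] ∈ P.tree) {s : Σ Γ : D.Seq, Board C (I.obj Γ)} (hs : s.1 = P.label n)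
    (hsF : ∀ γ ∈ s.2.control, γ ∈ F) : ∃ s', IsNext P F k n s i s' := by
  have hn' : n ∈ P.tree := P.prefix_closed _ _ (List.prefix_append _ _) hn
  obtain ⟨r, hr⟩ := hP n hn' (Preproof.back_eq_none_of_child hn)
  have hi : i < D.arity r := (P.rule_children n r hr i).1 hn
  obtain ⟨Γ, b⟩ := s
  have hX : Nat.card (I.obj Γ).carrier ≤ M := by
    have := hF.card_le n hn'
    rwa [← hs] at this
  have hY : Nat.card (I.obj (D.prem r ⟨i, hi⟩)).carrier ≤ M := by
    have := hF.card_le _ hn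
    rwa [P.rule_prem n r hr ⟨i, hi⟩] at this
  have hΓ : Γ = D.concl r := hs.trans (P.rule_concl n r hr)
  subst hΓ
  obtain ⟨K, rfl⟩ : ∃ K, k = K + 2 := ⟨k - 2, by have := hF.steps; omega⟩
  have hK : Nat.card (I.obj (D.concl r)).carrier * Nat.card A * F.card ≤ K := by
    have := hF.steps
    have h2 : Nat.card (I.obj (D.concl r)).carrier * Nat.card A * F.card ≤
        M * Nat.card A * F.card := by gcongr
    omega
  have hlen : (b.tidy (K + 2)).control.length ≤ M * Nat.card A :=
    (b.length_control_tidy hsF hK).trans (by gcongr)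
  obtain ⟨b', h1, h2⟩ := Board.exists_successor (I.mor r ⟨i, hi⟩) (b.tidy (K + 2)) F
    (fun γ hγ => hsF γ (b.tidy_control_subset _ hγ)) (by have := hF.chips; omega)
  exact ⟨_, r, hi, _, b', hr, rfl, rfl, h1, h2⟩

theorem Suffices.run_mem (hF : Suffices I P F k M) (hP : P.Closed) {w : List ℕ}
    (hw : P.unfoldNode w ∈ P.tree) : (run I P F k w).1 = P.label (P.unfoldNode w) ∧
      ∀ γ ∈ (run I P F k w).2.control, γ ∈ F := by
  induction w using List.reverseRecOn with
  | nil =>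
    rw [run_nil]
    exact ⟨rfl, by simp [Board.empty]⟩
  | append_singleton w i ih =>
    obtain ⟨h1, h2⟩ := ih (Preproof.unfoldNode_mem_of_concat hw)
    rw [Preproof.unfoldNode_concat] at hw ⊢
    obtain ⟨r, hi, b, b', hr, -, e, -, h⟩ := run_concat
      (hF.exists_isNext hP hw (h1.trans (Preproof.label_resolve _).symm) h2)
    rw [e]
    exact ⟨(P.rule_prem _ r hr ⟨i, hi⟩).symm, h⟩

theorem Suffices.isNext_run (hF : Suffices I P F k M) (hP : P.Closed) {w : List ℕ} {i : ℕ}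
    (hw : P.unfoldNode (w ++ [i]) ∈ P.tree) :
    IsNext P F k (P.resolve (P.unfoldNode w)) (run I P F k w) i (run I P F k (w ++ [i])) := by
  obtain ⟨h1, h2⟩ := hF.run_mem hP (Preproof.unfoldNode_mem_of_concat hw)
  rw [Preproof.unfoldNode_concat] at hw
  exact run_concat (hF.exists_isNext hP hw (h1.trans (Preproof.label_resolve _).symm) h2)

/-- The boards at the children are chosen separately, but all of them are successors of the one
tidied board at `w` along the one rule of `P` there. So they are the premises of a single annotated
rule. -/
theorem Suffices.exists_app (hF : Suffices I P F k M) (hP : P.Closed) {w : List ℕ}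
    (hw : P.unfoldNode w ∈ P.tree) :
    ∃ ρ : ResetRule C I, (∃ r b bs h, ρ = .app r b bs h ∧
        P.rule (P.resolve (P.unfoldNode w)) = some r) ∧
      (resetDerivation C I).concl ρ = tidySeq (run I P F k w) k ∧
      ∀ i : Fin ((resetDerivation C I).arity ρ),
        (resetDerivation C I).prem ρ i = run I P F k (w ++ [i.val]) := by
  have hres := Preproof.resolve_mem hw
  obtain ⟨r, hr⟩ := hP _ hres (Preproof.back_resolve _)
  have hnext : ∀ i : Fin (D.arity r), IsNext P F k (P.resolve (P.unfoldNode w)) (run I P F k w) i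
      (run I P F k (w ++ [i.val])) := fun i => by
    refine hF.isNext_run hP ?_
    rw [Preproof.unfoldNode_concat]
    exact (P.rule_children _ r hr i).2 i.2
  have hlabel : (run I P F k w).1 = D.concl r := by
    rw [(hF.run_mem hP hw).1, ← Preproof.label_resolve, P.rule_concl _ r hr]
  obtain ⟨b, hb⟩ : ∃ b, tidySeq (run I P F k w) k = ⟨D.concl r, b⟩ := by
    revert hlabel
    generalize run I P F k w = s
    obtain ⟨Γ, b⟩ := s
    rintro rfl
    exact ⟨_, rfl⟩
  have hbs : ∀ i : Fin (D.arity r), ∃ b', run I P F k (w ++ [i.val]) = ⟨D.prem r i, b'⟩ ∧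
      Board.Successor (I.mor r i) b b' := by
    intro i
    obtain ⟨r', hi, b₁, b', hr', h1, h2, h3, -⟩ := hnext i
    rw [hr] at hr'
    cases hr'
    rw [hb] at h1
    cases h1
    exact ⟨b', h2, h3⟩
  choose bs h1 h2 using hbs
  exact ⟨.app r b bs h2, ⟨r, b, bs, h2, rfl, hr⟩, hb.symm, fun i => (h1 i).symm⟩

theorem Suffices.exists_rules (hF : Suffices I P F k M) (hP : P.Closed) :
    ∃ ρ : List ℕ → ℕ → ResetRule C I, ∀ w, P.unfoldNode w ∈ P.tree →
      (∀ j < k, (ρ w j).IsStructural ∧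
        (resetDerivation C I).concl (ρ w j) = tidySeq (run I P F k w) j ∧
        (∀ i, (resetDerivation C I).prem (ρ w j) i = tidySeq (run I P F k w) (j + 1)) ∧
        ∀ γ, (run I P F k w).2.tidyChip j = some γ → ∃ Γ b b' h, ρ w j = .reset γ Γ b b' h) ∧
      (∃ r b bs h, ρ w k = .app r b bs h ∧ P.rule (P.resolve (P.unfoldNode w)) = some r) ∧
        (resetDerivation C I).concl (ρ w k) = tidySeq (run I P F k w) k ∧
        ∀ i : Fin ((resetDerivation C I).arity (ρ w k)),
          (resetDerivation C I).prem (ρ w k) i = run I P F k (w ++ [i.val]) := by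
  have : ∀ w j, ∃ ρ : ResetRule C I,
      (j < k → ρ.IsStructural ∧
        (resetDerivation C I).concl ρ = tidySeq (run I P F k w) j ∧
        (∀ i, (resetDerivation C I).prem ρ i = tidySeq (run I P F k w) (j + 1)) ∧
        ∀ γ, (run I P F k w).2.tidyChip j = some γ → ∃ Γ b b' h, ρ = .reset γ Γ b b' h) ∧
      (P.unfoldNode w ∈ P.tree → j = k →
        (∃ r b bs h, ρ = .app r b bs h ∧ P.rule (P.resolve (P.unfoldNode w)) = some r) ∧
        (resetDerivation C I).concl ρ = tidySeq (run I P F k w) k ∧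
        ∀ i : Fin ((resetDerivation C I).arity ρ),
          (resetDerivation C I).prem ρ i = run I P F k (w ++ [i.val])) := by
    intro w j
    -- Outside the infinite unfolding any rule will do; a structural one is always at hand.
    by_cases h : j < k ∨ P.unfoldNode w ∉ P.tree
    · obtain ⟨σ, hσ⟩ := exists_structural (run I P F k w) j
      refine ⟨σ, fun _ => hσ, fun hw hj => ?_⟩
      rcases h with h | h
      · omega
      · exact absurd hw h
    · push Not at h
      obtain ⟨τ, hτ⟩ := hF.exists_app hP h.2
      exact ⟨τ, fun hj => absurd hj (not_lt.2 h.1), fun _ _ => hτ⟩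
  choose ρ hρ using this
  exact ⟨ρ, fun w hw => ⟨fun j hj => (hρ w j).1 hj, (hρ w k).2 hw rfl⟩⟩

/-- The bud `w` of the infinite unfolding can be given the companion `d`. -/
def IsGood (I : TraceInterpretation.{u, v, w} D A) (P : Preproof D) (F : Finset C) (k : ℕ)
    (w d : List ℕ) : Prop :=
  P.IsCandidate w d ∧ run I P F k w = run I P F k d ∧ ∃ θ γ, θ.getLast? = some γ ∧
    (∀ u, d <+: u → u <+: w → u ≠ w → ∀ j ≤ k, θ <+: (tidySeq (run I P F k u) j).2.control) ∧
    θ <+: (run I P F k w).2.control ∧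
    ∃ u, d <+: u ∧ u <+: w ∧ u ≠ w ∧ ∃ j < k, (run I P F k u).2.tidyChip j = some γ

/-- On a branch of the infinite unfolding along which some prefix of the controls is eventually
constant and its greatest chip is reset infinitely often, all but finitely many nodes have good
companions. -/
theorem Suffices.exists_isGood (hF : Suffices I P F k M) (hP : P.Closed) {β : ℕ → List ℕ}
    (h0 : β 0 = []) (hβ : ∀ n, ∃ i, β (n + 1) = β n ++ [i])
    (hβP : ∀ n, P.unfoldNode (β n) ∈ P.tree) {θ : List C} {γ : C} (hθ : θ.getLast? = some γ)
    {N : ℕ} (hN : ∀ n ≥ N, ∀ j ≤ k, θ <+: (tidySeq (run I P F k (β n)) j).2.control)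
    (hinf : ∀ N, ∃ n ≥ N, ∃ j < k, (run I P F k (β n)).2.tidyChip j = some γ) :
    ∃ N, ∀ n ≥ N, ∃ d, IsGood I P F k (β n) d := by
  classical
  have : Finite A := ActivationAlgebra.finite
  -- The state of a position is its resolved node together with its annotated sequent. All chips
  -- come from `F`, so finitely many states occur.
  let f : ℕ → List ℕ × Σ Γ : D.Seq, Board C (I.obj Γ) :=
    fun n => (P.resolve (P.unfoldNode (β n)), run I P F k (β n))
  have hfin : (f '' Set.Ici N).Finite := by
    refine (P.finite.prod (P.finite.biUnion fun s _ =>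
      (Board.finite_setOf_control_subset (X := I.obj (P.label s)) F).image
        (Sigma.mk (β := fun Γ => Board C (I.obj Γ)) (P.label s)))).subset ?_
    rintro _ ⟨n, -, rfl⟩
    obtain ⟨h1, h2⟩ := hF.run_mem hP (hβP n)
    refine ⟨Preproof.resolve_mem (hβP n), Set.mem_biUnion (hβP n) ?_⟩
    revert h1 h2
    simp only [f]
    generalize run I P F k (β n) = s
    obtain ⟨Γ, b⟩ := s
    rintro rfl h2
    exact ⟨b, h2, rfl⟩
  have hrep : ∀ x, ∃ m, x ∈ f '' Set.Ici N → N ≤ m ∧ f m = x := by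
    intro x
    by_cases hx : x ∈ f '' Set.Ici N
    · obtain ⟨m, hm, rfl⟩ := hx
      exact ⟨m, fun _ => ⟨hm, rfl⟩⟩
    · exact ⟨0, fun h => absurd h hx⟩
  choose rep hrep using hrep
  -- Each state that occurs from `N` on has a fixed representative, and `M₁` bounds them all. A
  -- reset of `γ` at some `m ≥ M₁` then lies between every representative and every position after
  -- `m`.
  obtain ⟨M₁, hM₁⟩ := (hfin.image rep).bddAbove
  obtain ⟨m, hm, j, hj, hγ⟩ := hinf M₁
  refine ⟨max N (m + 1), fun n hn => ?_⟩
  have hnN : N ≤ n := (le_max_left _ _).trans hn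
  have hnm : m + 1 ≤ n := (le_max_right _ _).trans hn
  have hx : f n ∈ f '' Set.Ici N := ⟨n, hnN, rfl⟩
  obtain ⟨h1, h2⟩ := hrep _ hx
  have h3 : rep (f n) ≤ M₁ := hM₁ ⟨_, hx, rfl⟩
  set p := rep (f n)
  simp only [f, Prod.mk.injEq] at h2
  have hlen := branch_length h0 hβ
  refine ⟨β p, ⟨branch_prefix hβ (by omega), fun e => ?_, h2.1⟩, h2.2.symm, θ, γ, hθ, ?_, ?_,
    β m, branch_prefix hβ (by omega), branch_prefix hβ (by omega), fun e => ?_, j, hj, hγ⟩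
  · have := congrArg List.length e
    rw [hlen, hlen] at this
    omega
  · intro u hu1 hu2 hne j hj
    have hu := eq_branch_of_prefix h0 hβ hu2
    rw [hu]
    refine hN _ ?_ j hj
    have := hu1.length_le
    rw [hlen] at this
    omega
  · exact hN n hnN 0 (Nat.zero_le _)
  · have := congrArg List.length e
    rw [hlen, hlen] at this
    omega

end Run

/-! ### Branches -/

section Branch

universe u v w a c

variable {D : DerivationSystem.{u, v}} {A : Type a} [ActivationAlgebra A] {C : Type c}
  {I : TraceInterpretation.{u, v, w} D A} {P : Preproof D}

/-- The branch of `P` that corresponds to a branch `β` of its infinite unfolding, together with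
the positions on `β` to which its nodes belong. -/
def foldBranch (P : Preproof D) (β : ℕ → List ℕ) : ℕ → ℕ × List ℕ
  | 0 => (0, [])
  | t + 1 => match P.back (foldBranch P β t).2 with
    | some c => ((foldBranch P β t).1, c)
    | none => ((foldBranch P β t).1 + 1, P.unfoldNode (β ((foldBranch P β t).1 + 1)))

theorem foldBranch_of_some {β : ℕ → List ℕ} {t : ℕ} {c : List ℕ}
    (h : P.back (foldBranch P β t).2 = some c) :
    foldBranch P β (t + 1) = ((foldBranch P β t).1, c) := by
  simp [foldBranch, h]

theorem foldBranch_of_none {β : ℕ → List ℕ} {t : ℕ} (h : P.back (foldBranch P β t).2 = none) :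
    foldBranch P β (t + 1) =
      ((foldBranch P β t).1 + 1, P.unfoldNode (β ((foldBranch P β t).1 + 1))) := by
  simp [foldBranch, h]

/-- At a bud the branch of `P` takes an extra step to the companion, while the position on `β` stays
the same. So one position accounts for the bud as well as for the resolved node. -/
theorem foldBranch_cases {β : ℕ → List ℕ} (h0 : β 0 = []) (t : ℕ) :
    (foldBranch P β t).2 = P.unfoldNode (β (foldBranch P β t).1) ∨
      (foldBranch P β t).2 = P.resolve (P.unfoldNode (β (foldBranch P β t).1)) := by
  induction t with
  | zero => simp [foldBranch, h0]
  | succ t ih =>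
    rcases h : P.back (foldBranch P β t).2 with _ | c
    · rw [foldBranch_of_none h]
      exact Or.inl rfl
    · rw [foldBranch_of_some h]
      rcases ih with e | e
      · rw [e] at h
        exact Or.inr (Preproof.resolve_of_some h).symm
      · rw [e, Preproof.back_resolve] at h
        cases h

theorem foldBranch_of_back_eq_none {β : ℕ → List ℕ} (h0 : β 0 = []) {t : ℕ}
    (h : P.back (foldBranch P β t).2 = none) :
    (foldBranch P β t).2 = P.resolve (P.unfoldNode (β (foldBranch P β t).1)) := by
  rcases foldBranch_cases (P := P) h0 t with e | e
  · rw [e] at h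
    rw [e, Preproof.resolve_of_none h]
  · exact e

theorem label_foldBranch {β : ℕ → List ℕ} (h0 : β 0 = []) (t : ℕ) :
    P.label (foldBranch P β t).2 = P.label (P.unfoldNode (β (foldBranch P β t).1)) := by
  rcases foldBranch_cases (P := P) h0 t with e | e
  · rw [e]
  · rw [e, Preproof.label_resolve]

theorem foldBranch_concat {β : ℕ → List ℕ} (h0 : β 0 = []) (hβ : ∀ n, ∃ i, β (n + 1) = β n ++ [i])
    {t : ℕ} (h : P.back (foldBranch P β t).2 = none) :
    ∃ i, β ((foldBranch P β t).1 + 1) = β (foldBranch P β t).1 ++ [i] ∧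
      (foldBranch P β (t + 1)).2 = (foldBranch P β t).2 ++ [i] := by
  obtain ⟨i, hi⟩ := hβ (foldBranch P β t).1
  refine ⟨i, hi, ?_⟩
  rw [foldBranch_of_none h, foldBranch_of_back_eq_none h0 h, hi, Preproof.unfoldNode_concat]

theorem isBranch_foldBranch {β : ℕ → List ℕ} (h0 : β 0 = [])
    (hβ : ∀ n, ∃ i, β (n + 1) = β n ++ [i]) (hβP : ∀ n, P.unfoldNode (β n) ∈ P.tree) :
    P.IsBranch fun t => (foldBranch P β t).2 := by
  refine ⟨rfl, fun t => ?_⟩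
  have hmem : (foldBranch P β t).2 ∈ P.tree := by
    rcases foldBranch_cases (P := P) h0 t with e | e
    · rw [e]; exact hβP _
    · rw [e]; exact Preproof.resolve_mem (hβP _)
  rcases h : P.back (foldBranch P β t).2 with _ | c
  · obtain ⟨i, hi, e⟩ := foldBranch_concat h0 hβ h
    have hmem' : (foldBranch P β (t + 1)).2 ∈ P.tree := by
      rw [foldBranch_of_none h]; exact hβP _
    exact ⟨fun _ => ⟨hmem', i, e⟩, fun hl => absurd (e ▸ hmem') (hl.2 i)⟩
  · refine ⟨fun hl => absurd (P.bud_leaf _ _ h) hl, fun _ => ?_⟩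
    simp only [foldBranch_of_some h]

theorem foldBranch_le (β : ℕ → List ℕ) (t : ℕ) : (foldBranch P β t).1 ≤ t := by
  induction t with
  | zero => exact le_rfl
  | succ t ih =>
    rcases h : P.back (foldBranch P β t).2 with _ | c
    · rw [foldBranch_of_none h]; exact Nat.succ_le_succ ih
    · rw [foldBranch_of_some h]; exact ih.trans (Nat.le_succ t)

theorem foldBranch_mono (β : ℕ → List ℕ) : Monotone fun t => (foldBranch P β t).1 := by
  refine monotone_nat_of_le_succ fun t => ?_
  rcases h : P.back (foldBranch P β t).2 with _ | c
  · rw [foldBranch_of_none h]; exact Nat.le_succ _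
  · rw [foldBranch_of_some h]

theorem back_foldBranch_succ {β : ℕ → List ℕ} {t : ℕ} {c : List ℕ}
    (h : P.back (foldBranch P β t).2 = some c) : P.back (foldBranch P β (t + 1)).2 = none := by
  rw [foldBranch_of_some h]
  exact Preproof.back_companion h

theorem exists_foldBranch_eq (β : ℕ → List ℕ) (m : ℕ) :
    ∃ t, (foldBranch P β t).1 = m ∧ P.back (foldBranch P β t).2 = none := by
  have key : ∀ m t, (foldBranch P β t).1 = m →
      ∃ t, (foldBranch P β t).1 = m ∧ P.back (foldBranch P β t).2 = none := by
    intro m t ht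
    rcases h : P.back (foldBranch P β t).2 with _ | c
    · exact ⟨t, ht, h⟩
    · exact ⟨t + 1, by rw [foldBranch_of_some h]; exact ht, back_foldBranch_succ h⟩
  induction m with
  | zero => exact key 0 0 rfl
  | succ m ih =>
    obtain ⟨t, ht, h⟩ := ih
    exact key (m + 1) (t + 1) (by rw [foldBranch_of_none h, ht])

end Branch

/-! ### Following the stack of a thread along a branch -/

section Main

universe u v w a c

variable {D : DerivationSystem.{u, v}} {A : Type a} [ActivationAlgebra A] {C : Type c}
  {I : TraceInterpretation.{u, v, w} D A} {P : Preproof D}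

/-- `S` is a stack at the position `(x, a)` of the annotated sequent `s`, which extends `Γ`. -/
def HasStack (s : Σ Γ : D.Seq, Board C (I.obj Γ)) (Γ : D.Seq) (x : (I.obj Γ).carrier) (a : A)
    (S : Set C) : Prop :=
  ∃ b, s = ⟨Γ, b⟩ ∧ S ∈ b.stackSet x a

theorem HasStack.mem_control {s : Σ Γ : D.Seq, Board C (I.obj Γ)} {Γ : D.Seq}
    {x : (I.obj Γ).carrier} {a : A} {S : Set C} (h : HasStack s Γ x a S) :
    ∀ γ ∈ S, γ ∈ s.2.control := by
  obtain ⟨b, rfl, hS⟩ := h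
  exact b.stack_sub x a S hS

open Classical in
theorem HasStack.exists_tidy {s : Σ Γ : D.Seq, Board C (I.obj Γ)} {j : ℕ} {Γ : D.Seq}
    {x : (I.obj Γ).carrier} {a : A} {S : Set C} (h : HasStack (tidySeq s j) Γ x a S) :
    ∃ S', HasStack (tidySeq s (j + 1)) Γ x a S' ∧ StackStep (tidySeq s j).2.control
      (tidySeq s (j + 1)).2.control (s.2.tidyChip j) S S' := by
  obtain ⟨Γ', b⟩ := s
  obtain ⟨b₀, e, hS⟩ := h
  cases e
  obtain ⟨S', h1, h2⟩ := b.exists_tidy_stack j hS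
  exact ⟨S', ⟨_, rfl, h1⟩, h2⟩

theorem HasStack.of_eqToHom {Γ Γ' : D.Seq} (h : Γ = Γ') {x : (I.obj Γ).carrier} {c : A}
    {x' : (I.obj Γ').carrier}
    (hx : (x, c, x') ∈ TraceHom.rel (eqToHom (congrArg I.obj h))) :
    c = ⊥ ∧ ∀ (s : Σ Γ : D.Seq, Board C (I.obj Γ)) (a : A) (S : Set C),
      HasStack s Γ x a S → HasStack s Γ' x' a S := by
  subst h
  obtain ⟨h1, h2⟩ := hx
  dsimp only at h1 h2
  subst h1
  exact ⟨h2, fun _ _ _ h => h⟩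

-- The `if` matches the recursion of `accumulate`: a stack that would arrive at `act` is put back to
-- `⊥` with a fresh chip, and any other stack moves unchanged.
open Classical in
theorem HasStack.exists_next {Γ Γ' : D.Seq} {r : D.Rule} {i : Fin (D.arity r)}
    (hs : Γ = D.concl r) (ht : D.prem r i = Γ') {x : (I.obj Γ).carrier} {c : A}
    {x' : (I.obj Γ').carrier}
    (hx : (x, c, x') ∈ TraceHom.rel
      (eqToHom (congrArg I.obj hs) ≫ I.mor r i ≫ eqToHom (congrArg I.obj ht)))
    {b : Board C (I.obj (D.concl r))} {b' : Board C (I.obj (D.prem r i))}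
    (hb : Board.Successor (I.mor r i) b b') {a : A} {S : Set C}
    (h : HasStack ⟨D.concl r, b⟩ Γ x a S) :
    ∃ S', HasStack ⟨D.prem r i, b'⟩ Γ' x'
        (if a ⊔ c = ActivationAlgebra.act then ⊥ else a ⊔ c) S' ∧
      S ⊆ S' ∧ (a ⊔ c = ActivationAlgebra.act → ∃ f ∈ S', f ∉ b.control) := by
  subst hs ht
  rw [eqToHom_refl, eqToHom_refl, Category.id_comp, Category.comp_id] at hx
  obtain ⟨b₀, e, hS⟩ := h
  cases e
  split_ifs with hact
  · obtain ⟨S', h1, h2, h3⟩ := hb.exists_fresh hS hx hact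
    exact ⟨S', ⟨_, rfl, h1⟩, h2, fun _ => h3⟩
  · exact ⟨S, ⟨_, rfl, hb.mem_of_ne hS hx hact⟩, subset_rfl, fun h => absurd h hact⟩

theorem inducedPath_map_succ (π : ℕ → List ℕ) (n : ℕ) :
    (inducedPath I P π).map (homOfLE (Nat.le_succ n)) = stepHom I P (π n) (π (n + 1)) :=
  Functor.ofSequence_map_homOfLE_succ _ n

theorem tidySeq_control_sublist (s : Σ Γ : D.Seq, Board C (I.obj Γ)) (j : ℕ) :
    (tidySeq s (j + 1)).2.control.Sublist (tidySeq s j).2.control :=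
  s.2.tidy_control_sublist j

/-- On every branch of the infinite unfolding of a proof, some prefix of the controls is
eventually constant, and its greatest chip is reset infinitely often. -/
theorem Suffices.exists_infinite_resets {F : Finset C} {k M : ℕ} (hF : Suffices I P F k M)
    (hP : P ∈ (inducedSystem I).proofs) {β : ℕ → List ℕ} (h0 : β 0 = [])
    (hβ : ∀ n, ∃ i, β (n + 1) = β n ++ [i]) (hβP : ∀ n, P.unfoldNode (β n) ∈ P.tree) :
    ∃ θ γ, θ.getLast? = some γ ∧
      (∃ N, ∀ n ≥ N, ∀ j ≤ k, θ <+: (tidySeq (run I P F k (β n)) j).2.control) ∧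
      ∀ N, ∃ n ≥ N, ∃ j < k, (run I P F k (β n)).2.tidyChip j = some γ := by
  classical
  obtain ⟨hclosed, htrace⟩ := hP
  obtain ⟨t₀, y₀, c₀, hy₀, hc₀, hact₀⟩ := exists_thread (htrace _ (isBranch_foldBranch h0 hβ hβP))
  -- The stack has to start at a node that is not a bud, because only there the board is populated.
  obtain ⟨t₁, ht₁, hb₁⟩ : ∃ t₁ ≥ t₀, P.back (foldBranch P β t₁).2 = none := by
    rcases h : P.back (foldBranch P β t₀).2 with _ | c
    · exact ⟨t₀, le_rfl, h⟩
    · exact ⟨t₀ + 1, by omega, back_foldBranch_succ h⟩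
  let nd : ℕ → List ℕ := fun n => (foldBranch P β (t₁ + n)).2
  let y : (n : ℕ) → (I.obj (P.label (nd n))).carrier := fun n => y₀ (t₁ + n) (by omega)
  let c : ℕ → A := fun n => c₀ (t₁ + n)
  have hy : ∀ n, (y n, c n, y (n + 1)) ∈ TraceHom.rel (stepHom I P (nd n) (nd (n + 1))) := by
    intro n
    have := hy₀ (t₁ + n) (by omega)
    rw [inducedPath_map_succ] at this
    exact this
  have hc : ∀ n, c n ≤ ActivationAlgebra.act := fun n => hc₀ _ (by omega)
  let e := accumulate c
  have he : ∀ n, e (n + 1) =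
      if e n ⊔ c n = ActivationAlgebra.act then ⊥ else e n ⊔ c n := fun n => rfl
  -- Without activation after `N`, the running join would absorb a whole segment of the thread with
  -- total label `act`. Being at most `act`, it would then equal `act`, a value that `accumulate`
  -- never takes.
  have hinf : ∀ N, ∃ n ≥ N, e n ⊔ c n = ActivationAlgebra.act := by
    intro N
    by_contra hcon
    push Not at hcon
    obtain ⟨T₁, h1, -, T₂, h2, h3⟩ := hact₀ (t₁ + N)
    have h4 := h3 (fun t => e (t - t₁)) (by
      intro t ht1 ht2
      obtain ⟨n, rfl⟩ : ∃ n, t = t₁ + n := ⟨t - t₁, by omega⟩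
      have h5 := he n
      rw [if_neg (hcon n (by omega))] at h5
      simp only [show t₁ + n + 1 - t₁ = n + 1 by omega, Nat.add_sub_cancel_left]
      exact h5)
    rw [sup_eq_right.2 (accumulate_le hc _)] at h4
    exact accumulate_ne c _ h4
  let st : ℕ → Σ Γ : D.Seq, Board C (I.obj Γ) :=
    fun n => run I P F k (β (foldBranch P β (t₁ + n)).1)
  have hst : ∀ n, (st n).1 = P.label (nd n) ∧ ∀ γ ∈ (st n).2.control, γ ∈ F := by
    intro n
    obtain ⟨h1, h2⟩ := hF.run_mem hclosed (hβP (foldBranch P β (t₁ + n)).1)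
    exact ⟨h1.trans (label_foldBranch h0 _).symm, h2⟩
  -- A bud and its companion share one position on `β`, whose board must be tidied only once. This
  -- happens at the companion, and all micro steps at the bud are idle.
  let sq : ℕ → ℕ → Σ Γ : D.Seq, Board C (I.obj Γ) := fun n j =>
    if P.back (nd n) = none then tidySeq (st n) j else st n
  have hsq1 : ∀ {n}, P.back (nd n) = none → ∀ j, sq n j = tidySeq (st n) j := fun h j => if_pos h
  have hsq2 : ∀ {n}, P.back (nd n) ≠ none → ∀ j, sq n j = st n := fun h j => if_neg h
  have hsq0 : ∀ n, sq n 0 = st n := by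
    intro n
    by_cases h : P.back (nd n) = none
    · rw [hsq1 h]; rfl
    · rw [hsq2 h]
  let o : ℕ → ℕ → Option C := fun n j =>
    if P.back (nd n) = none then (st n).2.tidyChip j else none
  have hbud : ∀ n, P.back (nd n) ≠ none → st (n + 1) = st n := by
    intro n h
    obtain ⟨d, hd⟩ := Option.ne_none_iff_exists'.1 h
    simp only [st, ← add_assoc,
      foldBranch_of_some (show P.back (foldBranch P β (t₁ + n)).2 = _ from hd)]
  have hnext : ∀ n, P.back (nd n) = none → ∃ i, nd (n + 1) = nd n ++ [i] ∧
      IsNext P F k (nd n) (st n) i (st (n + 1)) := by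
    intro n h
    obtain ⟨i, h1, h2⟩ := foldBranch_concat h0 hβ h
    refine ⟨i, h2, ?_⟩
    have h3 := hF.isNext_run hclosed (h1 ▸ hβP _)
    rw [← foldBranch_of_back_eq_none h0 h, ← h1] at h3
    have h4 : (foldBranch P β (t₁ + (n + 1))).1 = (foldBranch P β (t₁ + n)).1 + 1 := by
      rw [← add_assoc, foldBranch_of_none h]
    simp only [st, h4]
    exact h3
  obtain ⟨θ, γ, hθ, ⟨N, hN⟩, hγ⟩ := exists_stable_prefix_reset (k := k)
    (by have := hF.steps; omega) (fun n j => (sq n j).2.control) (fun n j => (sq n j).2.nodup)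
    F F.finite_toSet
    (by
      intro n j γ hγ
      by_cases h : P.back (nd n) = none
      · rw [hsq1 h] at hγ
        exact (hst n).2 γ ((st n).2.tidy_control_subset j hγ)
      · rw [hsq2 h] at hγ
        exact (hst n).2 γ hγ)
    -- The stacks followed lie at the current point `y n` of the thread and at the activation `e n`
    -- accumulated so far.
    o (fun n j => {S | HasStack (sq n j) (P.label (nd n)) (y n) (e n) S})
    (fun n j S hS => HasStack.mem_control hS)
    (by
      rw [hsq1 (n := 0) hb₁]
      have h1 := (hst 0).1
      generalize y 0 = x
      revert h1 x
      generalize st 0 = s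
      generalize P.label (nd 0) = Γ
      obtain ⟨Γ', b⟩ := s
      rintro rfl x
      -- As `e 0 = ⊥`, population supplies a stack at the starting position.
      obtain ⟨S, hS⟩ := b.tidy_one_nonempty x
      exact ⟨S, _, rfl, hS⟩)
    (by
      intro n j hj
      by_cases h : P.back (nd n) = none
      · rw [hsq1 h, hsq1 h]
        exact ControlStep.of_sublist (tidySeq_control_sublist _ _)
      · rw [hsq2 h, hsq2 h]
        exact ControlStep.of_sublist (List.Sublist.refl _))
    (by
      intro n
      rw [hsq0]
      by_cases h : P.back (nd n) = none
      · obtain ⟨i, -, r, hi, b, b', -, h1, h2, h3, -⟩ := hnext n h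
        rw [hsq1 h, h1, h2]
        exact h3.controlStep
      · rw [hsq2 h, hbud n h]
        exact ControlStep.of_sublist (List.Sublist.refl _))
    (by
      intro n j hj S hS
      by_cases h : P.back (nd n) = none
      · simp only [o, if_pos h]
        rw [hsq1 h] at hS ⊢
        rw [hsq1 h]
        exact HasStack.exists_tidy hS
      · rw [hsq2 h] at hS ⊢
        exact ⟨S, hS, Board.StackStep.refl _ _ _ _⟩)
    (fun n => e n ⊔ c n = ActivationAlgebra.act)
    (by
      intro n S hS
      have hS : HasStack (sq n k) (P.label (nd n)) (y n) (e n) S := hS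
      simp only [hsq0]
      by_cases h : P.back (nd n) = none
      · rw [hsq1 h] at hS ⊢
        obtain ⟨i, hi, r, hir, b, b', hr, h1, h2, h3, -⟩ := hnext n h
        rw [h1] at hS ⊢
        rw [h2]
        rcases hy n with ⟨r', i', hs, ht, hr', hi', hmem⟩ | ⟨-, hb, -⟩
        · rw [hr] at hr'
          cases hr'
          obtain rfl : i' = ⟨i, hir⟩ := by
            rw [hi] at hi'
            exact Fin.ext (by simpa using hi'.symm)
          obtain ⟨S', h4, h5, h6⟩ := HasStack.exists_next hs ht hmem h3 hS
          exact ⟨S', by rw [← he] at h4; exact h4, fun m hm hm' => absurd (h5 hm) hm', h6⟩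
        · rw [h] at hb
          cases hb
      · rw [hsq2 h] at hS ⊢
        rw [hbud n h]
        rcases hy n with ⟨r', i', hs, ht, hr', -⟩ | ⟨hl, hb, hmem⟩
        · exact absurd (P.rule_dom _ _ hr').2 h
        · obtain ⟨h1, h2⟩ := HasStack.of_eqToHom (C := C) hl hmem
          have h3 : e n ⊔ c n = e n := by rw [h1, sup_bot_eq]
          have h4 : e (n + 1) = e n := by
            rw [he, h3, if_neg (accumulate_ne c n)]
          refine ⟨S, ?_, Board.StackStep.refl _ _ _ _, fun h => ?_⟩
          · show HasStack _ _ _ (e (n + 1)) S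
            rw [h4]
            exact h2 _ _ _ hS
          · rw [h3] at h
            exact absurd h (accumulate_ne c n))
    hinf
  refine ⟨θ, γ, hθ, ⟨t₁ + N, fun m hm j hj => ?_⟩, fun m => ?_⟩
  · obtain ⟨t, ht, hb⟩ := exists_foldBranch_eq (P := P) β m
    -- Position `m` is reached no earlier than at step `m`, so a bound on steps is also a bound on
    -- positions.
    have hle := foldBranch_le (P := P) β t
    obtain ⟨n, rfl⟩ : ∃ n, t = t₁ + n := ⟨t - t₁, by omega⟩
    have := hN n (by omega) j hj
    rw [hsq1 hb] at this
    rw [← ht]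
    exact this
  · obtain ⟨t, ht, -⟩ := exists_foldBranch_eq (P := P) β m
    obtain ⟨n, hn, j, hj, h⟩ := hγ t
    simp only [o] at h
    split_ifs at h with hb
    refine ⟨_, ?_, j, hj, h⟩
    rw [← ht]
    exact foldBranch_mono β (by omega)

/-- The tree of `P` is finite, so its trace objects have bounded size. This bound determines the
number of chips in `F`, which in turn determines `k`. -/
theorem exists_suffices [Infinite C] (I : TraceInterpretation.{u, v, w} D A) (P : Preproof D) :
    ∃ (F : Finset C) (k M : ℕ), Suffices I P F k M := by
  obtain ⟨M, hM⟩ := (P.finite.image fun s => Nat.card (I.obj (P.label s)).carrier).bddAbove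
  obtain ⟨F, hF⟩ := Infinite.exists_subset_card_eq C (M * Nat.card A + M)
  exact ⟨F, M * Nat.card A * F.card + 2, M, fun s hs => hM ⟨s, hs, rfl⟩, hF.ge, le_rfl⟩

end Main

end CyclicReset

theorem mainTheorem3 {A : Type*} [CyclicReset.ActivationAlgebra A]
    {C : Type*} [Countable C] [Infinite C]
    (D : CyclicReset.DerivationSystem) (I : CyclicReset.TraceInterpretation D A)
    (Γ : D.Seq) (P : CyclicReset.Preproof D)
    (hP : P ∈ (CyclicReset.inducedSystem I).proofs) (hΓ : P.endsequent = Γ) :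
    ∃ P' ∈ (CyclicReset.resetSystem C I).proofs,
      P'.endsequent = (⟨Γ, CyclicReset.Board.empty C (I.obj Γ)⟩ :
        Σ Γ : D.Seq, CyclicReset.Board C (I.obj Γ)) ∧
      ∃ Q : CyclicReset.Preproof D, CyclicReset.IsStrip P' Q ∧ CyclicReset.IsUnfolding P Q := by
  open CyclicReset in
  obtain ⟨F, k, M, hF⟩ := exists_suffices (C := C) I P
  have hclosed : P.Closed := hP.1
  obtain ⟨Q, p, hQ, hq, hgood⟩ := exists_good_unfolding P (IsGood I P F k) (fun w d h => h.1)
    (fun β h0 hβ hβP => by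
      obtain ⟨θ, γ, hθ, ⟨N, hN⟩, hinf⟩ := hF.exists_infinite_resets hP h0 hβ hβP
      obtain ⟨N', hN'⟩ := hF.exists_isGood hclosed h0 hβ hβP hθ hN hinf
      exact ⟨N', fun n hn _ => hN' n hn⟩)
  obtain ⟨ρ, hρ⟩ := hF.exists_rules hclosed
  have hann : IsAnnotation Q k (fun w j => tidySeq (run I P F k w) j) ρ :=
    { label := fun w hw j => by
        rw [hq.label w hw]
        exact (hF.run_mem hclosed (hq.mem w hw)).1
      -- A good companion carries the same annotated sequent as its bud, so the bud remains a bud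
      -- after annotation.
      back := fun w d hd => congrArg (fun s => tidySeq s 0) (hgood w d hd).2.1
      structural := fun w hw _ j hj => ((hρ w (hq.mem w hw)).1 j hj).1
      app := fun w hw hb => by
        rw [hq.rule_inner w hw hb]
        exact (hρ w (hq.mem w hw)).2.1
      concl := fun w hw _ j hj => by
        rcases hj.lt_or_eq with hj | rfl
        · exact ((hρ w (hq.mem w hw)).1 j hj).2.1
        · exact (hρ w (hq.mem w hw)).2.2.1
      prem := fun w hw _ j hj => ((hρ w (hq.mem w hw)).1 j hj).2.2.1
      prem_app := fun w hw _ i => (hρ w (hq.mem w hw)).2.2.2 i }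
  refine ⟨annotate hann, annotate_mem_proofs hann fun w d hd => ?_, ?_, Q, isStrip_annotate hann,
    p, hQ⟩
  · obtain ⟨-, -, θ, γ, h1, h2, h3, u, hdu, huw, hne, j, hj, hγ⟩ := hgood w d hd
    have hu : u ∈ Q.tree := Q.prefix_closed _ _ huw (Q.bud_leaf w d hd).1
    exact ⟨θ, γ, h1, h2, h3, u, hdu, huw, hne, j, hj,
      ((hρ u (hq.mem u hu)).1 j hj).2.2.2 γ hγ⟩
  · subst hΓ
    have : run I P F k [] = ⟨P.label [], Board.empty C _⟩ := run_nil
    show tidySeq (run I P F k []) 0 = _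
    rw [this]
    rfl
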